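/- **Setting.** Let $p,M\in\mathbb N$, $0\le T<\infty$ and $\mathbb S=\{1,\dots,p\}$. Let $\alpha=(\alpha_x)_{x\in\mathbb S}$ be a probability vector and let $\theta_0=(\phi_{x,m},\,q_{xy,m}: x,y\in\mathbb S,\ y\ne x,\ 1\le m\le M)$ satisfy $\phi_{x,m}\ge 0$, $\sum_{m}\phi_{x,m}=1$ for every $x$, and $q_{xy,m}\ge 0$ for $y\neq x$. Put $q_{xx,m}=-\sum_{y\ne x}q_{xy,m}$ and $Q_m=[q_{xy,m}]_{xy}$. Let $(X,\Phi)$ be a mixture of Markov jump processes with these parameters: $X=(X(t))_{t\ge0}$ takes values in $\mathbb S$ and almost surely has right-continuous paths with left limits, $\Phi$ takes values in $\{1,\dots,M\}$, $\mathbb P\{X(0)=x\}=\alpha_x$, $\mathbb P\{\Phi=m\mid X(0)=x\}=\phi_{x,m}$, and, conditionally on $\Phi=m$ and $X(0)$, $X$ is a time-homogeneous Markov process with transition rates $q_{xy,m}=\lim_{h\downarrow0}\frac1h\big(\mathbb P\{X(h)=y\mid\Phi=m,X(0)=x\}-\delta_x(y)\big)$; here $\delta_a(b)=1$ if $a=b$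 and $0$ otherwise. Let $\Phi_m=\mathbf 1\{\Phi=m\}$, $B_x=\mathbf 1\{X(0)=x\}$, let $N_{xy}$ be the number of jumps of $X$ from $x$ to $y$ in $(0,T]$, and $T_x=\int_0^T\mathbf 1\{X(u)=x\}\,du$. The complete-data log-likelihood (up to the term $\sum_x B_x\log\alpha_x$, which is free of $\theta$), as a function of the free coordinates $\theta=(\phi_{x,m},q_{xy,m}: y\ne x)$ and with the constraints $\sum_m\phi_{x,m}=1$ taken into account by the second term, is $$\log f_\theta(X,\Phi)=\sum_{m,x}\Phi_mB_x\log\phi_{x,m}-\sum_xB_x\Big(\sum_m\phi_{x,m}-1\Big)+\sum_{m,x}\Big(\sum_{y\ne x}\Phi_mN_{xy}\log q_{xy,m}-\Big(\sum_{y\neq x}q_{xy,m}\Big)\Phi_mT_x\Big).$$ The complete-data expected Fisher information is the expectation of the product of scores, $$I_c(\theta_i,\theta_j)=\mathbb E_{\theta_0}\Big[\frac{\partial\log f_\theta(X,\Phi)}{\partial\theta_i}\,\frac{\partial\log f_\theta(X,\Phi)}{\partial\theta_j}\Big]\Big|_{\theta=\theta_0},$$ and we write $H(\theta_i,\theta_j)=-\mathbb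 E_{\theta_0}\big[\partial^2\log f_\theta(X,\Phi)/\partial\theta_i\partial\theta_j\big]\big|_{\theta=\theta_0}$. **Statement.** For all coordinates that are nonzero at $\theta_0$ these derivatives exist and the expectations are of integrable random variables. Moreover, for all $x,y,x',y'\in\mathbb S$ and $1\le m,n\le M$ such that the parameters $\phi$ and $q$ at which $I_c$ is evaluated are nonzero (and, for the intensities, $y\ne x$, $y'\neq x'$): $$I_c(\phi_{x,m},\phi_{y,n})=\frac{\alpha_y}{\phi_{x,m}}\,\delta_x(y)\big(\delta_m(n)-\phi_{x,m}\big),\qquad I_c(\phi_{x',n},q_{xy,m})=I_c(q_{xy,m},\phi_{x',n})=0,$$ $$I_c(q_{xy,m},q_{x'y',n})=\frac{\delta_m(n)\,\delta_x(x')\,\delta_y(y')}{q_{x'y',n}}\ \alpha^\top S_n\int_0^Te^{Q_nu}e_x\,du,\qquad S_n=\mathrm{diag}(\phi_{1,n},\dots,\phi_{p,n}),$$ with $e_x$ the $x$-th unit vector. So $I_c(\theta_0)$ is block diagonal. The formulas for the cross terms and for the $q$-block also hold with $H$ in place of $I_c$. If all $\phi_{x,m}$ are nonzero, the $\phi$-blocks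 of $H$ and $I_c$ agree as bilinear forms on the directions tangent to the constraints: $\sum_{x,m,y,n}v_{x,m}w_{y,n}H(\phi_{x,m},\phi_{y,n})=\sum_{x,m,y,n}v_{x,m}w_{y,n}I_c(\phi_{x,m},\phi_{y,n})$ whenever $\sum_mv_{x,m}=\sum_mw_{x,m}=0$ for all $x$. -/

import Mathlib

open scoped NNReal Topology Matrix
open MeasureTheory

noncomputable section

namespace MixtureMJP

/-- The coordinates of the parameter `θ = (φ, q)`: the regime probabilities `φ_{x,m}`, and the
intensities `q_{xy,m}` with `x ≠ y`. -/
abbrev ParamIdx (p M : ℕ) : Type :=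
  (Fin p × Fin M) ⊕ ({xy : Fin p × Fin p // xy.1 ≠ xy.2} × Fin M)

/-- The coordinate `φ_{x,m}`. -/
abbrev phiIdx {p M : ℕ} (x : Fin p) (m : Fin M) : ParamIdx p M := Sum.inl (x, m)

/-- The coordinate `q_{xy,m}`, where `x ≠ y`. -/
abbrev rateIdx {p M : ℕ} (x y : Fin p) (h : x ≠ y) (m : Fin M) : ParamIdx p M :=
  Sum.inr (⟨(x, y), h⟩, m)

/-- The value of `φ_{x,m}` in `θ`. -/
def phi {p M : ℕ} (θ : ParamIdx p M → ℝ) (x : Fin p) (m : Fin M) : ℝ := θ (phiIdx x m)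

/-- The value of `q_{xy,m}` in `θ` (it is only used for `x ≠ y`). -/
def rate {p M : ℕ} (θ : ParamIdx p M → ℝ) (m : Fin M) (x y : Fin p) : ℝ :=
  if h : x ≠ y then θ (rateIdx x y h m) else 0

/-- The intensity matrix `Q_m`: the off-diagonal entries are `q_{xy,m}`, and
`q_{xx,m} = - ∑_{y ≠ x} q_{xy,m}`. -/
def intensity {p M : ℕ} (θ : ParamIdx p M → ℝ) (m : Fin M) : Matrix (Fin p) (Fin p) ℝ :=
  Matrix.of fun x y => if x = y then -∑ z ∈ Finset.univ.erase x, rate θ m x z else rate θ m x y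

/-- Admissible parameters: every `(φ_{x,m})_m` is a probability vector, and the off-diagonal
intensities are nonnegative. -/
structure IsAdmissible {p M : ℕ} (θ : ParamIdx p M → ℝ) : Prop where
  phi_nonneg : ∀ x m, 0 ≤ phi θ x m
  phi_sum : ∀ x, ∑ m, phi θ x m = 1
  rate_nonneg : ∀ m x y, x ≠ y → 0 ≤ rate θ m x y

/-! ### The process -/

/-- `P` is a stochastic transition semigroup on the states `Fin p` whose transition rates at time
`0` are the entries of `Q`. -/
structure IsTransitionFunction {p : ℕ} (P : ℝ≥0 → Matrix (Fin p) (Fin p) ℝ)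
    (Q : Matrix (Fin p) (Fin p) ℝ) : Prop where
  nonneg : ∀ t x y, 0 ≤ P t x y
  row_sum : ∀ t x, ∑ y, P t x y = 1
  zero : P 0 = 1
  add : ∀ s t, P (s + t) = P s * P t
  rate : ∀ x y, Filter.Tendsto
    (fun h : ℝ≥0 => (P h x y - if x = y then 1 else 0) / (h : ℝ)) (𝓝[>] 0) (𝓝 (Q x y))

/-- Paths of jump processes: right-continuous with left limits, for the discrete topology. -/
structure IsJumpPath {p : ℕ} (γ : ℝ≥0 → Fin p) : Prop where
  right_cont : ∀ t, ∀ᶠ s in 𝓝[>] t, γ s = γ t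
  left_lim : ∀ t, ∃ x, ∀ᶠ s in 𝓝[<] t, γ s = x

/-- `(X, Φ)` is a mixture of Markov jump processes with initial law `α` and parameter `θ`: the
initial state has law `α`; given `X 0 = x`, the regime `Φ` equals `m` with probability
`φ_{x,m}`; and given `Φ = m` and `X 0`, the process `X` is a time-homogeneous Markov jump process
with intensity matrix `Q_m`. The joint law is given through the finite-dimensional
distributions at times `0 = t_0 ≤ t_1 ≤ ... ≤ t_n`; the case `n = 0` is the law of `(X 0, Φ)`. -/
structure IsMixture {p M : ℕ} {Ω : Type*} [MeasurableSpace Ω] (μ : Measure Ω)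
    (X : ℝ≥0 → Ω → Fin p) (Φ : Ω → Fin M) (α : Fin p → ℝ) (θ : ParamIdx p M → ℝ) : Prop where
  measurable_process : ∀ t, Measurable (X t)
  measurable_regime : Measurable Φ
  paths : ∀ᵐ ω ∂μ, IsJumpPath fun t => X t ω
  law : ∃ P : Fin M → ℝ≥0 → Matrix (Fin p) (Fin p) ℝ,
    (∀ m, IsTransitionFunction (P m) (intensity θ m)) ∧
    ∀ (m : Fin M) (n : ℕ) (t : Fin (n + 1) → ℝ≥0) (s : Fin (n + 1) → Fin p),
      Monotone t → t 0 = 0 →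
      μ.real {ω | Φ ω = m ∧ ∀ i, X (t i) ω = s i} =
        α (s 0) * phi θ (s 0) m *
          ∏ i : Fin n, P m (t i.succ - t i.castSucc) (s i.castSucc) (s i.succ)

/-! ### The statistics and the complete-data log-likelihood -/

/-- `B_x`: the indicator that the path starts in `x`. -/
def initInd {p : ℕ} (γ : ℝ≥0 → Fin p) (x : Fin p) : ℝ := if γ 0 = x then 1 else 0

/-- `N_{xy}`: the number of times in `(0, T]` at which the path jumps from `x` to `y`. -/
def jumpCount {p : ℕ} (T : ℝ≥0) (γ : ℝ≥0 → Fin p) (x y : Fin p) : ℝ :=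
  ({t : ℝ≥0 | t ∈ Set.Ioc 0 T ∧ (∀ᶠ s in 𝓝[<] t, γ s = x) ∧ γ t = y}.ncard : ℝ)

/-- `T_x`: the total time in `[0, T]` that the path spends in `x`. -/
def occTime {p : ℕ} (T : ℝ≥0) (γ : ℝ≥0 → Fin p) (x : Fin p) : ℝ :=
  ∫ u in (0 : ℝ)..T, if γ u.toNNReal = x then 1 else 0

/-- The indicator `Φ_m` that the regime `k` equals `m`. -/
def regimeInd {M : ℕ} (k m : Fin M) : ℝ := if k = m then 1 else 0

/-- The complete-data log-likelihood of the path `γ` on `[0, T]` and the regime `k`, up to the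
summand `∑ x, B_x log α_x`, which is free of `θ`; the constraints `∑ m, φ_{x,m} = 1` enter through
the term `-∑ x, B_x (∑ m, φ_{x,m} - 1)`. -/
def logLik {p M : ℕ} (T : ℝ≥0) (γ : ℝ≥0 → Fin p) (k : Fin M) (θ : ParamIdx p M → ℝ) : ℝ :=
  (∑ m, ∑ x, regimeInd k m * initInd γ x * Real.log (phi θ x m))
    - (∑ x, initInd γ x * ((∑ m, phi θ x m) - 1))
    + ∑ m, ∑ x,
      ((∑ y ∈ Finset.univ.erase x, regimeInd k m * jumpCount T γ x y * Real.log (rate θ m x y))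
        - (∑ y ∈ Finset.univ.erase x, rate θ m x y) * (regimeInd k m * occTime T γ x))

/-- The partial derivative of `F` with respect to the coordinate `i`, at `θ`. -/
def partialD {ι : Type*} [DecidableEq ι] (i : ι) (F : (ι → ℝ) → ℝ) (θ : ι → ℝ) : ℝ :=
  deriv (fun s : ℝ => F (Function.update θ i s)) (θ i)

/-- The score `∂ log f_θ(γ, k) / ∂θ_i`. -/
def score {p M : ℕ} (T : ℝ≥0) (θ : ParamIdx p M → ℝ) (i : ParamIdx p M) (γ : ℝ≥0 → Fin p)
    (k : Fin M) : ℝ :=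
  partialD i (logLik T γ k) θ

/-- The second derivative `∂² log f_θ(γ, k) / ∂θ_i ∂θ_j`. -/
def hess {p M : ℕ} (T : ℝ≥0) (θ : ParamIdx p M → ℝ) (i j : ParamIdx p M) (γ : ℝ≥0 → Fin p)
    (k : Fin M) : ℝ :=
  partialD i (fun θ' => partialD j (logLik T γ k) θ') θ

/-- The complete-data expected Fisher information `I_c(θ_i, θ_j)`: the expectation of the product
of the scores. -/
def completeInfo {p M : ℕ} {Ω : Type*} [MeasurableSpace Ω] (μ : Measure Ω) (T : ℝ≥0)
    (X : ℝ≥0 → Ω → Fin p) (Φ : Ω → Fin M) (θ : ParamIdx p M → ℝ) (i j : ParamIdx p M) : ℝ :=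
  ∫ ω, score T θ i (fun t => X t ω) (Φ ω) * score T θ j (fun t => X t ω) (Φ ω) ∂μ

/-- The negative expected second derivative of the complete-data log-likelihood. -/
def hessInfo {p M : ℕ} {Ω : Type*} [MeasurableSpace Ω] (μ : Measure Ω) (T : ℝ≥0)
    (X : ℝ≥0 → Ω → Fin p) (Φ : Ω → Fin M) (θ : ParamIdx p M → ℝ) (i j : ParamIdx p M) : ℝ :=
  -∫ ω, hess T θ i j (fun t => X t ω) (Φ ω) ∂μ

/-- `αᵀ S_n ∫_0^T exp(Q_n u) e_x du`, with `S_n = diag(φ_{1,n}, ..., φ_{p,n})`. -/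
def expectedOcc {p M : ℕ} (T : ℝ≥0) (α : Fin p → ℝ) (θ : ParamIdx p M → ℝ) (n : Fin M)
    (x : Fin p) : ℝ :=
  α ⬝ᵥ (Matrix.diagonal (fun z => phi θ z n) *ᵥ
    fun z => ∫ u in (0 : ℝ)..T, (NormedSpace.exp (u • intensity θ n) *ᵥ Pi.single x 1) z)

/-- Kronecker's `δ_a(b)`. -/
def kron {β : Type*} [DecidableEq β] (a b : β) : ℝ := if b = a then 1 else 0

end MixtureMJP

end

open MixtureMJP

/-! The log-likelihood is a sum over coordinates of `a_i log θ_i - b_i θ_i`, plus a constant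
(`logLik_eq_sum`). Hence the score is `a_i / θ_i - b_i` and the Hessian is diagonal. For `φ_{x,m}`
the score is `(Φ_m / φ_{x,m} - 1) B_x`; for `q_{xy,m}` it is `Φ_m (N_xy - q_{xy,m} T_x) / q_{xy,m}`,
a compensated jump count divided by its rate. Since `Φ_m Φ_n = δ_m(n) Φ_m`, every expectation that
involves a rate reduces to one under `μ` restricted to `{Φ = m}`. That is a finite measure under
which `X` is a Markov chain with initial weights `α_z φ_{z,m}` (`exists_isChain`).

For such a chain three facts are needed. Compensated counts are orthogonal to the initial state
(`integral_init_mul_compCount`). Those of different types are orthogonal to each other, and the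
second moment of one is `q_xy E[T_x]` (`integral_compCount_mul`). Finally `E[T_x]` is an integral of
matrix exponentials (`integral_occTime`), because the forward equation forces `P t = exp(tQ)`
(`eq_exp`).

The first two facts come from discretization. On a regular grid the compensated moves form a sum of
martingale increments, whose moments follow from the finite-dimensional laws. Along almost every
path this sum converges to the compensated count. Fatou's lemma bounds the second moment of the jump
counts, and the total jump count, now in `L²`, dominates the grid sums (`gridCount_le`), so
expectations converge too.

In the `φ`-block, `H` exceeds `I_c` by `δ_x(y) α_y`, which does not depend on the regimes and so
vanishes on directions tangent to the constraints. -/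

namespace MixtureMJP

/-! ### Jump paths: counting jumps on a fine grid. -/

/-- The times in `(a, b]` at which the path jumps from `x` to `y`. -/
def jumpSet {p : ℕ} (γ : ℝ≥0 → Fin p) (x y : Fin p) (a b : ℝ≥0) : Set ℝ≥0 :=
  {t : ℝ≥0 | t ∈ Set.Ioc a b ∧ (∀ᶠ s in 𝓝[<] t, γ s = x) ∧ γ t = y}

theorem jumpSet_mono {p : ℕ} (γ : ℝ≥0 → Fin p) (x y : Fin p) {a b a' b' : ℝ≥0}
    (ha : a' ≤ a) (hb : b ≤ b') : jumpSet γ x y a b ⊆ jumpSet γ x y a' b' :=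
  fun _ ht => ⟨⟨ha.trans_lt ht.1.1, ht.1.2.trans hb⟩, ht.2⟩

theorem nhdsLT_neBot_of_lt {a t : ℝ≥0} (h : a < t) : (𝓝[<] t).NeBot :=
  nhdsLT_neBot_of_exists_lt ⟨a, h⟩

theorem IsJumpPath.exists_ball {p : ℕ} {γ : ℝ≥0 → Fin p} (hγ : IsJumpPath γ) (t : ℝ≥0) :
    ∃ ε > 0, ∃ l, ∀ s ∈ Metric.ball t ε, (s < t → γ s = l) ∧ (t ≤ s → γ s = γ t) := by
  obtain ⟨l, hl⟩ := hγ.left_lim t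
  have hr := hγ.right_cont t
  rw [eventually_nhdsWithin_iff] at hl hr
  obtain ⟨ε, hε, h⟩ := Metric.eventually_nhds_iff_ball.1 (hl.and hr)
  refine ⟨ε, hε, l, fun s hs => ⟨(h s hs).1, fun hts => ?_⟩⟩
  rcases hts.eq_or_lt with rfl | hlt
  · rfl
  · exact (h s hs).2 hlt

/-- On the ball the path is a step function whose only possible discontinuity is `t`, so its values
at the two endpoints decide whether the jump occurs. -/
theorem jumpSet_of_ball {p : ℕ} {γ : ℝ≥0 → Fin p} {t : ℝ≥0} {ε : ℝ} {l : Fin p}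
    (h : ∀ s ∈ Metric.ball t ε, (s < t → γ s = l) ∧ (t ≤ s → γ s = γ t))
    {a b : ℝ≥0} (hab : a ≤ b) (ha : a ∈ Metric.ball t ε) (hb : b ∈ Metric.ball t ε)
    {x y : Fin p} (hxy : x ≠ y) :
    jumpSet γ x y a b = if γ a = x ∧ γ b = y then {t} else ∅ := by
  have hball : ∀ s ∈ Set.Ioc a b, s ∈ Metric.ball t ε := by
    intro s hs
    rw [Metric.mem_ball, NNReal.dist_eq, abs_lt] at *
    have h1 : (a : ℝ) < s := by exact_mod_cast hs.1
    have h2 : (s : ℝ) ≤ b := by exact_mod_cast hs.2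
    constructor <;> linarith [ha.1, hb.2]
  have hne : ∀ s ∈ jumpSet γ x y a b, s = t := by
    rintro s ⟨hs, hl, hr⟩
    have hsb := hball s hs
    have := nhdsLT_neBot_of_lt hs.1
    by_contra hst
    have hnear : ∀ᶠ u in 𝓝[<] s, γ u = γ s := by
      refine nhdsWithin_le_nhds ?_
      have hmem := Metric.isOpen_ball.mem_nhds hsb
      rcases lt_or_gt_of_ne hst with hlt | hlt
      · filter_upwards [hmem, Iio_mem_nhds hlt] with u hu hut
        rw [(h u hu).1 hut, (h s hsb).1 hlt]
      · filter_upwards [hmem, Ioi_mem_nhds hlt] with u hu hut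
        rw [(h u hu).2 (le_of_lt hut), (h s hsb).2 hlt.le]
    obtain ⟨u, hu1, hu2⟩ := (hl.and hnear).exists
    exact hxy (by rw [← hu1, hu2, hr])
  by_cases htab : t ∈ Set.Ioc a b
  · have := nhdsLT_neBot_of_lt htab.1
    have htb : t ∈ Metric.ball t ε := hball t htab
    have hleft : ∀ᶠ u in 𝓝[<] t, γ u = l := by
      rw [eventually_nhdsWithin_iff]
      filter_upwards [Metric.isOpen_ball.mem_nhds htb] with u hu hut
      exact (h u hu).1 hut
    rw [(h a ha).1 htab.1, (h b hb).2 htab.2]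
    split_ifs with hc
    · refine Set.Subset.antisymm (fun s hs => hne s hs) ?_
      rintro s rfl
      exact ⟨htab, by simpa only [hc.1] using hleft, hc.2⟩
    · refine Set.eq_empty_of_forall_notMem fun s hs => hc ?_
      obtain rfl := hne s hs
      obtain ⟨u, hu1, hu2⟩ := (hs.2.1.and hleft).exists
      exact ⟨hu2.symm.trans hu1, hs.2.2⟩
  · have hab' : γ a = γ b := by
      rw [Set.mem_Ioc, not_and_or, not_lt, not_le] at htab
      rcases htab with h1 | h1
      · rw [(h a ha).2 h1, (h b hb).2 (h1.trans hab)]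
      · rw [(h a ha).1 (hab.trans_lt h1), (h b hb).1 h1]
    rw [if_neg (fun hc => hxy (by rw [← hc.1, hab', hc.2]))]
    refine Set.eq_empty_of_forall_notMem fun s hs => htab ?_
    rw [← hne s hs]
    exact hs.1

/-- `δ` is a Lebesgue number of the cover of the compact interval `[0, T]` by the balls of
`exists_ball`. -/
theorem IsJumpPath.exists_mesh {p : ℕ} {γ : ℝ≥0 → Fin p} (hγ : IsJumpPath γ) (T : ℝ≥0) :
    ∃ δ > (0 : ℝ), ∀ a b : ℝ≥0, a ≤ b → b ≤ T → (b : ℝ) - a < δ → ∀ x y : Fin p, x ≠ y →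
      (jumpSet γ x y a b).Finite ∧
      (jumpSet γ x y a b).ncard = if γ a = x ∧ γ b = y then 1 else 0 := by
  choose ε hε l h using hγ.exists_ball
  obtain ⟨δ, hδ, hδ'⟩ := lebesgue_number_lemma_of_metric (c := fun t => Metric.ball t (ε t))
    (isCompact_Icc (a := (0 : ℝ≥0)) (b := T)) (fun _ => Metric.isOpen_ball)
    (fun t _ => Set.mem_iUnion.2 ⟨t, Metric.mem_ball_self (hε t)⟩)
  refine ⟨δ, hδ, fun a b hab hbT hd x y hxy => ?_⟩
  obtain ⟨t, ht⟩ := hδ' a ⟨zero_le, hab.trans hbT⟩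
  have hab' : (a : ℝ) ≤ b := by exact_mod_cast hab
  rw [jumpSet_of_ball (h t) hab (ht (Metric.mem_ball_self hδ))
    (ht (by rw [Metric.mem_ball, NNReal.dist_eq, abs_of_nonneg (by linarith)]; exact hd)) hxy]
  split_ifs <;> simp

/-- The `i`-th point of the subdivision of `[0, T]` into `n` intervals of the same length. -/
noncomputable def grid (T : ℝ≥0) (n i : ℕ) : ℝ≥0 := i * (T / n)

theorem grid_mono (T : ℝ≥0) (n : ℕ) : Monotone (grid T n) := fun i j hij => by
  unfold grid; gcongr

theorem grid_zero (T : ℝ≥0) (n : ℕ) : grid T n 0 = 0 := by simp [grid]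

theorem grid_self (T : ℝ≥0) {n : ℕ} (hn : n ≠ 0) : grid T n n = T := by
  have : (n : ℝ≥0) ≠ 0 := by exact_mod_cast hn
  unfold grid; field_simp

theorem grid_succ (T : ℝ≥0) (n i : ℕ) : grid T n (i + 1) = grid T n i + T / n := by
  unfold grid; push_cast; ring

theorem ncard_jumpSet_eq_sum {p : ℕ} (γ : ℝ≥0 → Fin p) (x y : Fin p) {g : ℕ → ℝ≥0}
    (hg : Monotone g) (n : ℕ) (hfin : ∀ i < n, (jumpSet γ x y (g i) (g (i + 1))).Finite) :
    (jumpSet γ x y (g 0) (g n)).Finite ∧ (jumpSet γ x y (g 0) (g n)).ncard =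
      ∑ i ∈ Finset.range n, (jumpSet γ x y (g i) (g (i + 1))).ncard := by
  induction n with
  | zero => simp [jumpSet]
  | succ n ih =>
    obtain ⟨h1, h2⟩ := ih fun i hi => hfin i (hi.trans n.lt_succ_self)
    have h3 := hfin n n.lt_succ_self
    have hU : jumpSet γ x y (g 0) (g (n + 1)) =
        jumpSet γ x y (g 0) (g n) ∪ jumpSet γ x y (g n) (g (n + 1)) := by
      ext t
      have h0 : g 0 ≤ g n := hg (Nat.zero_le n)
      have hn : g n ≤ g (n + 1) := hg n.le_succ
      simp only [jumpSet, Set.mem_ofPred_eq, Set.mem_union, ← Set.Ioc_union_Ioc_eq_Ioc h0 hn]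
      tauto
    have hdisj : Disjoint (jumpSet γ x y (g 0) (g n)) (jumpSet γ x y (g n) (g (n + 1))) :=
      Set.disjoint_left.2 fun t ht ht' => absurd ht.1.2 (not_le.2 ht'.1.1)
    rw [hU, Set.ncard_union_eq hdisj h1 h3, h2, Finset.sum_range_succ]
    exact ⟨h1.union h3, rfl⟩

/-- The number of grid intervals over which the path moves from `x` to `y`. -/
noncomputable def gridCount {p : ℕ} (T : ℝ≥0) (γ : ℝ≥0 → Fin p) (x y : Fin p) (n : ℕ) : ℝ :=
  ∑ i ∈ Finset.range n, if γ (grid T n i) = x ∧ γ (grid T n (i + 1)) = y then 1 else 0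

/-- Once the mesh is below the `δ` of the path, each grid interval contains at most one jump and its
endpoints reveal it. The threshold `n₀` depends on the path, so this gives pathwise convergence
only. -/
theorem IsJumpPath.exists_eq_gridCount {p : ℕ} {γ : ℝ≥0 → Fin p} (hγ : IsJumpPath γ) (T : ℝ≥0) :
    ∃ n₀ : ℕ, ∀ n ≥ n₀, ∀ x y : Fin p, x ≠ y →
      (jumpSet γ x y 0 T).Finite ∧ jumpCount T γ x y = gridCount T γ x y n := by
  obtain ⟨δ, hδ, h⟩ := hγ.exists_mesh T
  obtain ⟨n₀, hn₀⟩ := exists_nat_gt ((T : ℝ) / δ)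
  refine ⟨n₀ + 1, fun n hn x y hxy => ?_⟩
  have hn0 : n ≠ 0 := by omega
  have hmesh : ∀ i < n, _ := fun i hi => h (grid T n i) (grid T n (i + 1))
    (grid_mono T n i.le_succ)
    ((grid_mono T n (Nat.succ_le_of_lt hi)).trans_eq (grid_self T hn0)) (by
      rw [grid_succ]
      push_cast
      rw [add_sub_cancel_left]
      have h1 : (n₀ : ℝ) + 1 ≤ n := by exact_mod_cast hn
      rw [div_lt_iff₀ hδ] at hn₀
      rw [div_lt_iff₀ (by positivity)]
      nlinarith) x y hxy
  obtain ⟨h1, h2⟩ := ncard_jumpSet_eq_sum γ x y (grid_mono T n) n fun i hi => (hmesh i hi).1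
  rw [grid_zero, grid_self T hn0] at h1 h2
  refine ⟨h1, ?_⟩
  change ((jumpSet γ x y 0 T).ncard : ℝ) = _
  rw [h2, gridCount, Nat.cast_sum]
  refine Finset.sum_congr rfl fun i hi => ?_
  rw [(hmesh i (Finset.mem_range.1 hi)).2]
  push_cast
  rfl

/-- Without jumps the path would be continuous on `[a, b]` into a discrete space, hence constant by
connectedness. -/
theorem IsJumpPath.exists_mem_jumpSet {p : ℕ} {γ : ℝ≥0 → Fin p} (hγ : IsJumpPath γ)
    {a b : ℝ≥0} (hab : a ≤ b) (hne : γ a ≠ γ b) :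
    ∃ x y, x ≠ y ∧ (jumpSet γ x y a b).Nonempty := by
  by_contra! hcon
  refine hne (isPreconnected_Icc.constant (s := Set.Icc a b) (f := γ) ?_
    (Set.left_mem_Icc.2 hab) (Set.right_mem_Icc.2 hab))
  intro t ht
  rw [ContinuousWithinAt, nhds_discrete, Filter.tendsto_pure, eventually_nhdsWithin_iff]
  obtain ⟨ε, hε, l, h⟩ := hγ.exists_ball t
  have hl : a < t → l = γ t := by
    intro hat
    by_contra hl
    refine Set.notMem_empty t (hcon l (γ t) hl ▸ ⟨⟨hat, ht.2⟩, ?_, rfl⟩)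
    rw [eventually_nhdsWithin_iff]
    filter_upwards [Metric.ball_mem_nhds t hε] with u hu hut
    exact (h u hu).1 hut
  filter_upwards [Metric.ball_mem_nhds t hε] with s hs hsab
  rcases lt_or_ge s t with hst | hst
  · rw [(h s hs).1 hst, hl (hsab.1.trans_lt hst)]
  · exact (h s hs).2 hst

/-- The number of all jumps in `(0, T]`. -/
noncomputable def totalCount {p : ℕ} (T : ℝ≥0) (γ : ℝ≥0 → Fin p) : ℝ :=
  ∑ uv : Fin p × Fin p with uv.1 ≠ uv.2, jumpCount T γ uv.1 uv.2

theorem gridCount_nonneg {p : ℕ} (T : ℝ≥0) (γ : ℝ≥0 → Fin p) (x y : Fin p) (n : ℕ) :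
    0 ≤ gridCount T γ x y n :=
  Finset.sum_nonneg fun _ _ => by positivity

/-- A bound uniform in `n`, used for domination. A move from `x` to `y` over a grid interval may
pass through other states, so it need not contain a jump of that type, but it contains some jump;
hence the total count. -/
theorem IsJumpPath.gridCount_le {p : ℕ} {γ : ℝ≥0 → Fin p} (hγ : IsJumpPath γ) (T : ℝ≥0)
    {x y : Fin p} (hxy : x ≠ y) (n : ℕ) : gridCount T γ x y n ≤ totalCount T γ := by
  obtain ⟨n₀, hn₀⟩ := hγ.exists_eq_gridCount T
  have hfin := fun (u v : Fin p) (huv : u ≠ v) => (hn₀ n₀ le_rfl u v huv).1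
  rcases eq_or_ne n 0 with rfl | hn
  · simp only [gridCount, Finset.range_zero, Finset.sum_empty]
    exact Finset.sum_nonneg fun _ _ => by unfold jumpCount; positivity
  have hle : ∀ i < n, grid T n (i + 1) ≤ T := fun i hi =>
    (grid_mono T n (Nat.succ_le_of_lt hi)).trans_eq (grid_self T hn)
  have hsum : totalCount T γ = ∑ i ∈ Finset.range n, ∑ uv : Fin p × Fin p with uv.1 ≠ uv.2,
      ((jumpSet γ uv.1 uv.2 (grid T n i) (grid T n (i + 1))).ncard : ℝ) := by
    rw [Finset.sum_comm]
    refine Finset.sum_congr rfl fun uv huv => ?_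
    have huv' := (Finset.mem_filter.1 huv).2
    have := (ncard_jumpSet_eq_sum γ uv.1 uv.2 (grid_mono T n) n fun i hi =>
      (hfin _ _ huv').subset (jumpSet_mono γ _ _ zero_le (hle i hi))).2
    rw [grid_zero, grid_self T hn] at this
    change ((jumpSet γ uv.1 uv.2 0 T).ncard : ℝ) = _
    rw [this, Nat.cast_sum]
  rw [hsum]
  refine Finset.sum_le_sum fun i hi => ?_
  split_ifs with hc
  · obtain ⟨u, v, huv, hne⟩ := hγ.exists_mem_jumpSet (grid_mono T n i.le_succ)
      (by rw [hc.1, hc.2]; exact hxy)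
    have hpos := (Set.ncard_pos ((hfin u v huv).subset
      (jumpSet_mono γ _ _ zero_le (hle i (Finset.mem_range.1 hi))))).2 hne
    refine le_trans (by exact_mod_cast hpos) (Finset.single_le_sum
      (f := fun uv : Fin p × Fin p =>
        ((jumpSet γ uv.1 uv.2 (grid T n i) (grid T n (i + 1))).ncard : ℝ))
      (fun _ _ => by positivity) (Finset.mem_filter.2 ⟨Finset.mem_univ (u, v), huv⟩))
  · positivity

/-! ### Riemann sums of right-continuous functions. -/

/-- The left Riemann sum of `f` on the regular subdivision of `[0, T]` into `n` intervals. -/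
noncomputable def gridSum (T : ℝ≥0) (f : ℝ≥0 → ℝ) (n : ℕ) : ℝ :=
  ∑ i ∈ Finset.range n, ((T / n : ℝ≥0) : ℝ) * f (grid T n i)

theorem tendsto_mesh (T : ℝ≥0) :
    Filter.Tendsto (fun n : ℕ => ((T / n : ℝ≥0) : ℝ)) Filter.atTop (𝓝 0) := by
  simpa using tendsto_const_div_atTop_nhds_zero_nat (T : ℝ)

theorem abs_gridSum_le (T : ℝ≥0) {f : ℝ≥0 → ℝ} {C : ℝ} (hf : ∀ t, |f t| ≤ C) (n : ℕ) :
    |gridSum T f n| ≤ T * C := by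
  have hC : 0 ≤ C := (abs_nonneg _).trans (hf 0)
  rcases eq_or_ne n 0 with rfl | hn
  · simp only [gridSum, Finset.range_zero, Finset.sum_empty, abs_zero]; positivity
  calc |gridSum T f n| ≤ ∑ i ∈ Finset.range n, ((T / n : ℝ≥0) : ℝ) * C := by
        refine (Finset.abs_sum_le_sum_abs _ _).trans (Finset.sum_le_sum fun i _ => ?_)
        rw [abs_mul, abs_of_nonneg (NNReal.coe_nonneg _)]
        gcongr
        exact hf _
    _ = T * C := by
        have : (n : ℝ) ≠ 0 := by exact_mod_cast hn
        simp only [Finset.sum_const, Finset.card_range, nsmul_eq_mul]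
        push_cast
        field_simp

/-- The difference of the left and right sums telescopes. -/
theorem abs_gridSum_succ_sub_le (T : ℝ≥0) {f : ℝ≥0 → ℝ} {C : ℝ} (hf : ∀ t, |f t| ≤ C) (n : ℕ) :
    |gridSum T f n - ∑ i ∈ Finset.range n, ((T / n : ℝ≥0) : ℝ) * f (grid T n (i + 1))| ≤
      ((T / n : ℝ≥0) : ℝ) * (2 * C) := by
  rw [gridSum, ← Finset.sum_sub_distrib]
  have : ∀ i ∈ Finset.range n, ((T / n : ℝ≥0) : ℝ) * f (grid T n i) -
      ((T / n : ℝ≥0) : ℝ) * f (grid T n (i + 1)) =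
      ((T / n : ℝ≥0) : ℝ) * (f (grid T n i) - f (grid T n (i + 1))) := fun i _ => by ring
  rw [Finset.sum_congr rfl this, ← Finset.mul_sum, Finset.sum_range_sub', abs_mul,
    abs_of_nonneg (NNReal.coe_nonneg _)]
  gcongr
  calc |f (grid T n 0) - f (grid T n n)| ≤ |f (grid T n 0)| + |f (grid T n n)| := abs_sub _ _
    _ ≤ 2 * C := by linarith [hf (grid T n 0), hf (grid T n n)]

theorem tendsto_gridSum (T : ℝ≥0) {f : ℝ≥0 → ℝ} {C : ℝ} (hf : ∀ t, |f t| ≤ C)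
    (hcont : ∀ t, Filter.Tendsto f (𝓝[>] t) (𝓝 (f t))) :
    Filter.Tendsto (gridSum T f) Filter.atTop (𝓝 (∫ u in (0 : ℝ)..T, f u.toNNReal)) := by
  rcases eq_or_lt_of_le (zero_le : 0 ≤ T) with rfl | hT
  · have : gridSum 0 f = fun _ => 0 := by ext n; simp [gridSum]
    simp [this]
  -- The step function that samples `f` at the first grid point strictly after `u`. Strictness
  -- matters because `hcont` controls `f` only from the right; this yields the right sums, and the
  -- left sums follow by telescoping.
  let F : ℕ → ℝ → ℝ := fun n u => f (((⌊u * n / T⌋₊ + 1 : ℕ) : ℝ≥0) * (T / n))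
  have hTr : (0 : ℝ) < T := by exact_mod_cast hT
  have hFm : ∀ n, Measurable (F n) := fun n =>
    (measurable_from_nat (f := fun k : ℕ => f (((k + 1 : ℕ) : ℝ≥0) * (T / n)))).comp
      (Nat.measurable_floor.comp (by fun_prop))
  have hFi : ∀ n a b, IntervalIntegrable (F n) volume a b := fun n a b =>
    (intervalIntegrable_const (c := C)).mono_fun (hFm n).aestronglyMeasurable
      (Filter.Eventually.of_forall fun u =>
        ((hf _).trans (le_abs_self C)))
  have hlim : Filter.Tendsto (fun n => ∫ u in (0 : ℝ)..T, F n u) Filter.atTop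
      (𝓝 (∫ u in (0 : ℝ)..T, f u.toNNReal)) := by
    refine intervalIntegral.tendsto_integral_filter_of_dominated_convergence (fun _ => C)
      (Filter.Eventually.of_forall fun n => (hFm n).aestronglyMeasurable)
      (Filter.Eventually.of_forall fun n => Filter.Eventually.of_forall fun u _ => hf _)
      intervalIntegrable_const (Filter.Eventually.of_forall fun u hu => ?_)
    rw [Set.uIoc_of_le hTr.le] at hu
    refine (hcont _).comp (tendsto_nhdsWithin_iff.2 ⟨?_, ?_⟩)
    · rw [← NNReal.tendsto_coe, Real.coe_toNNReal _ hu.1.le]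
      refine tendsto_of_tendsto_of_tendsto_of_le_of_le' tendsto_const_nhds
        (h := fun n : ℕ => u + ((T / n : ℝ≥0) : ℝ)) ?_ ?_ ?_
      · simpa using tendsto_const_nhds.add (tendsto_mesh T)
      all_goals
        filter_upwards [Filter.eventually_gt_atTop 0] with n hn
        have hn' : (0 : ℝ) < n := by exact_mod_cast hn
        push_cast
      · have := Nat.lt_floor_add_one (u * n / T)
        rw [div_lt_iff₀ hTr] at this
        rw [← mul_div_assoc, le_div_iff₀ hn']
        exact this.le
      · have := Nat.floor_le (a := u * n / T) (by have := hu.1; positivity)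
        rw [le_div_iff₀ hTr] at this
        rw [← mul_div_assoc, div_le_iff₀ hn', add_mul, add_mul, div_mul_cancel₀ _ hn'.ne']
        linarith
    · filter_upwards [Filter.eventually_gt_atTop 0] with n hn
      have hn' : (0 : ℝ) < n := by exact_mod_cast hn
      rw [Set.mem_Ioi, ← NNReal.coe_lt_coe, Real.coe_toNNReal _ hu.1.le]
      push_cast
      have := Nat.lt_floor_add_one (u * n / T)
      rw [div_lt_iff₀ hTr] at this
      rw [← mul_div_assoc, lt_div_iff₀ hn']
      exact this
  have heq : ∀ n : ℕ, 0 < n → ∫ u in (0 : ℝ)..T, F n u =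
      ∑ i ∈ Finset.range n, ((T / n : ℝ≥0) : ℝ) * f (grid T n (i + 1)) := by
    intro n hn
    have hn' : (0 : ℝ) < n := by exact_mod_cast hn
    have := intervalIntegral.sum_integral_adjacent_intervals (f := F n) (μ := volume)
      (a := fun i => (grid T n i : ℝ)) (n := n) (fun _ _ => hFi _ _ _)
    simp only [grid_zero, grid_self T hn.ne', NNReal.coe_zero] at this
    rw [← this]
    refine Finset.sum_congr rfl fun i _ => ?_
    have hlt : (grid T n i : ℝ) ≤ grid T n (i + 1) := by exact_mod_cast grid_mono T n i.le_succ
    rw [intervalIntegral.integral_congr_ae (g := fun _ => f (grid T n (i + 1)))]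
    · rw [intervalIntegral.integral_const, grid_succ, NNReal.coe_add, add_sub_cancel_left,
        smul_eq_mul]
    -- At the right endpoint itself the floor already jumps to `i + 1`.
    · have hae : ∀ᵐ u : ℝ, u ≠ grid T n (i + 1) :=
        compl_mem_ae_iff.2 (measure_singleton _)
      filter_upwards [hae] with u hu hmem
      rw [Set.uIoc_of_le hlt] at hmem
      have h1 := hmem.1
      have h2 := lt_of_le_of_ne hmem.2 hu
      have hfl : ⌊u * n / T⌋₊ = i := by
        unfold grid at h1 h2
        push_cast at h1 h2
        rw [← mul_div_assoc] at h1 h2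
        rw [div_lt_iff₀ hn'] at h1
        rw [lt_div_iff₀ hn'] at h2
        rw [Nat.floor_eq_iff]
        · exact ⟨by rw [le_div_iff₀ hTr]; exact h1.le, by rwa [div_lt_iff₀ hTr]⟩
        · have : 0 ≤ u * n := le_trans (by positivity) h1.le
          positivity
      simp only [F, hfl, grid]
  have hright : Filter.Tendsto
      (fun n : ℕ => ∑ i ∈ Finset.range n, ((T / n : ℝ≥0) : ℝ) * f (grid T n (i + 1)))
      Filter.atTop (𝓝 (∫ u in (0 : ℝ)..T, f u.toNNReal)) :=
    hlim.congr' ((Filter.eventually_gt_atTop 0).mono heq)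
  have hdiff : Filter.Tendsto (fun n => gridSum T f n -
      ∑ i ∈ Finset.range n, ((T / n : ℝ≥0) : ℝ) * f (grid T n (i + 1))) Filter.atTop (𝓝 0) :=
    squeeze_zero_norm (fun n => abs_gridSum_succ_sub_le T hf n)
      (by simpa using (tendsto_mesh T).mul_const (2 * C))
  simpa using hdiff.add hright

/-! ### Transition functions are matrix exponentials. -/

namespace IsTransitionFunction

variable {p : ℕ} {P : ℝ≥0 → Matrix (Fin p) (Fin p) ℝ} {Q : Matrix (Fin p) (Fin p) ℝ}

theorem le_one (h : IsTransitionFunction P Q) (t : ℝ≥0) (x y : Fin p) : P t x y ≤ 1 :=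
  (Finset.single_le_sum (fun z _ => h.nonneg t x z) (Finset.mem_univ y)).trans_eq (h.row_sum t x)

theorem tendsto_zero (h : IsTransitionFunction P Q) (x y : Fin p) :
    Filter.Tendsto (fun t => P t x y) (𝓝 0) (𝓝 ((1 : Matrix (Fin p) (Fin p) ℝ) x y)) := by
  have h0 : (1 : Matrix (Fin p) (Fin p) ℝ) x y = P 0 x y := by rw [h.zero]
  have hid : Filter.Tendsto (fun t : ℝ≥0 => (t : ℝ)) (𝓝[>] 0) (𝓝 0) := by
    have := (NNReal.continuous_coe.tendsto 0).mono_left (nhdsWithin_le_nhds (s := Set.Ioi 0))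
    simpa using this
  have h1 : Filter.Tendsto (fun t => P t x y) (𝓝[>] 0) (𝓝 (P 0 x y)) := by
    rw [← h0, Matrix.one_apply]
    have := ((h.rate x y).mul hid).add_const (if x = y then (1 : ℝ) else 0)
    rw [mul_zero, zero_add] at this
    refine this.congr' ?_
    filter_upwards [self_mem_nhdsWithin] with t ht
    have : (t : ℝ) ≠ 0 := by exact_mod_cast (ne_of_gt ht)
    rw [div_mul_cancel₀ _ this]; ring
  rw [h0]
  have h2 : ContinuousWithinAt (fun t => P t x y) (Set.Ici 0) 0 :=
    continuousWithinAt_Ioi_iff_Ici.1 h1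
  -- In `ℝ≥0` the point `0` is the least one, so right continuity there is continuity.
  have h3 : (Set.Ici 0 : Set ℝ≥0) = Set.univ := Set.eq_univ_of_forall fun t => Set.mem_Ici.2 zero_le
  rw [h3, continuousWithinAt_univ] at h2
  exact h2

/-- By the semigroup property `P (s + d) - P s = P s (P d - 1)`, and the entries of `P s` lie in
`[0, 1]`; continuity at `0` therefore spreads to all times, from both sides. -/
theorem continuous_apply (h : IsTransitionFunction P Q) (x y : Fin p) :
    Continuous fun t => P t x y := by
  have hle : ∀ s t : ℝ≥0, s ≤ t → |P t x y - P s x y| ≤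
      ∑ z, |P (nndist s t) z y - (1 : Matrix (Fin p) (Fin p) ℝ) z y| := by
    intro s t hst
    obtain ⟨d, rfl⟩ := exists_add_of_le hst
    have hd : nndist s (s + d) = d := by
      rw [nndist_comm, NNReal.nndist_eq, add_tsub_cancel_left, tsub_eq_zero_of_le hst, max_eq_left zero_le]
    have : P (s + d) x y - P s x y =
        ∑ z, P s x z * (P d z y - (1 : Matrix (Fin p) (Fin p) ℝ) z y) := by
      calc P (s + d) x y - P s x y = (P s * (P d - 1)) x y := by
            rw [h.add, mul_sub, mul_one, Matrix.sub_apply]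
        _ = _ := by rw [Matrix.mul_apply]; rfl
    rw [this, hd]
    refine (Finset.abs_sum_le_sum_abs _ _).trans (Finset.sum_le_sum fun z _ => ?_)
    rw [abs_mul, abs_of_nonneg (h.nonneg _ _ _)]
    exact mul_le_of_le_one_left (abs_nonneg _) (h.le_one _ _ _)
  rw [continuous_iff_continuousAt]
  intro t
  rw [ContinuousAt, tendsto_iff_norm_sub_tendsto_zero]
  refine squeeze_zero (g := fun s => ∑ z, |P (nndist s t) z y -
    (1 : Matrix (Fin p) (Fin p) ℝ) z y|) (fun _ => norm_nonneg _) (fun s => ?_) ?_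
  · rw [Real.norm_eq_abs]
    rcases le_total s t with hst | hst
    · rw [abs_sub_comm]; exact hle s t hst
    · rw [nndist_comm]; exact hle t s hst
  · have hz : Filter.Tendsto (fun s => nndist s t) (𝓝 t) (𝓝 0) := by
      have : Continuous fun s : ℝ≥0 => nndist s t := by fun_prop
      simpa using this.tendsto t
    have : ∀ z ∈ Finset.univ, Filter.Tendsto (fun s => |P (nndist s t) z y -
        (1 : Matrix (Fin p) (Fin p) ℝ) z y|) (𝓝 t) (𝓝 0) := fun z _ => by
      simpa using (((h.tendsto_zero z y).comp hz).sub_const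
        ((1 : Matrix (Fin p) (Fin p) ℝ) z y)).abs
    simpa using tendsto_finsetSum _ this

section Exponential

attribute [local instance] Matrix.linftyOpNormedRing Matrix.linftyOpNormedAlgebra

theorem hasDerivWithinAt (h : IsTransitionFunction P Q) {t : ℝ} (ht : 0 ≤ t) :
    HasDerivWithinAt (fun u : ℝ => P u.toNNReal) (P t.toNNReal * Q) (Set.Ici t) t := by
  refine hasDerivWithinAt_iff_tendsto_slope.2 ?_
  rw [Set.Ici_sdiff_left]
  have hQ : Filter.Tendsto (fun d : ℝ≥0 => (d : ℝ)⁻¹ • (P d - 1)) (𝓝[>] 0) (𝓝 Q) := by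
    refine tendsto_pi_nhds.2 fun x => tendsto_pi_nhds.2 fun y => ?_
    refine (h.rate x y).congr fun d => ?_
    rw [Matrix.smul_apply, Matrix.sub_apply, Matrix.one_apply, smul_eq_mul, div_eq_inv_mul]
  have hd : Filter.Tendsto (fun u : ℝ => (u - t).toNNReal) (𝓝[>] t) (𝓝[>] 0) := by
    refine tendsto_nhdsWithin_iff.2 ⟨?_, ?_⟩
    · have : Continuous fun u : ℝ => (u - t).toNNReal := by fun_prop
      simpa using (this.tendsto t).mono_left nhdsWithin_le_nhds
    · filter_upwards [self_mem_nhdsWithin] with u hu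
      exact Real.toNNReal_pos.2 (sub_pos.2 hu)
  refine ((hQ.comp hd).const_mul (P t.toNNReal)).congr' ?_
  filter_upwards [self_mem_nhdsWithin] with u hu
  have hut : 0 ≤ u - t := (sub_pos.2 hu).le
  have : u.toNNReal = t.toNNReal + (u - t).toNNReal := by
    rw [← Real.toNNReal_add ht hut]; congr 1; ring
  rw [slope_def_module, this, h.add, Function.comp_apply, Real.coe_toNNReal _ hut, mul_smul_comm,
    mul_sub, mul_one]

/-- The forward equation is available only for the right derivative. It makes the right derivative
of `P u * exp(-uQ)` vanish, and together with continuity this suffices for the product to be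
constant. -/
theorem eq_exp (h : IsTransitionFunction P Q) (t : ℝ≥0) :
    P t = NormedSpace.exp ((t : ℝ) • Q) := by
  have hexp : ∀ u : ℝ, HasDerivAt (fun u : ℝ => NormedSpace.exp (u • (-Q)))
      (-Q * NormedSpace.exp (u • (-Q))) u := fun u => hasDerivAt_exp_smul_const' (-Q) u
  have hPc : Continuous fun u : ℝ => P u.toNNReal :=
    (continuous_pi fun x => continuous_pi fun y => h.continuous_apply x y).comp
      continuous_real_toNNReal
  have hconst := constant_of_has_deriv_right_zero (a := 0) (b := (t : ℝ))
    (f := fun u : ℝ => P u.toNNReal * NormedSpace.exp (u • (-Q)))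
    ((hPc.mul (continuous_iff_continuousAt.2 fun u => (hexp u).continuousAt)).continuousOn)
    (fun u hu => by
      have := (h.hasDerivWithinAt hu.1).mul (hexp u).hasDerivWithinAt
      refine this.congr_deriv ?_
      rw [mul_assoc, neg_mul, mul_neg, add_neg_cancel])
    t ⟨t.2, le_rfl⟩
  simp only [Real.toNNReal_coe, Real.toNNReal_zero, h.zero, zero_smul, NormedSpace.exp_zero,
    mul_one] at hconst
  rw [smul_neg] at hconst
  calc P t = P t * (NormedSpace.exp (-((t : ℝ) • Q)) * NormedSpace.exp ((t : ℝ) • Q)) := by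
        rw [← Matrix.exp_add_of_commute _ _ (Commute.refl ((t : ℝ) • Q)).neg_left,
          neg_add_cancel, NormedSpace.exp_zero, mul_one]
    _ = _ := by rw [← mul_assoc, hconst, one_mul]

end Exponential

/-- Over time steps `T / n`, the probability of moving from `x` to `y` is `T / n` times a sequence
with limit `Q x y`. -/
theorem exists_rate (h : IsTransitionFunction P Q) (T : ℝ≥0) {x y : Fin p} (hxy : x ≠ y) :
    ∃ r : ℕ → ℝ, Filter.Tendsto r Filter.atTop (𝓝 (Q x y)) ∧
      ∀ n : ℕ, P (T / n) x y = ((T / n : ℝ≥0) : ℝ) * r n := by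
  rcases eq_or_lt_of_le (zero_le : 0 ≤ T) with rfl | hT
  -- For `T = 0` the quotient used below would be `0 / 0 = 0`, with the wrong limit.
  · exact ⟨fun _ => Q x y, tendsto_const_nhds, fun n => by simp [h.zero, hxy]⟩
  refine ⟨fun n => P (T / n) x y / ((T / n : ℝ≥0) : ℝ), ?_, fun n => ?_⟩
  · have hm : Filter.Tendsto (fun n : ℕ => T / (n : ℝ≥0)) Filter.atTop (𝓝[>] 0) := by
      refine tendsto_nhdsWithin_iff.2 ⟨?_, ?_⟩
      · rw [← NNReal.tendsto_coe]; exact tendsto_mesh T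
      · filter_upwards [Filter.eventually_gt_atTop 0] with n hn
        have : (0 : ℝ≥0) < n := by exact_mod_cast hn
        exact div_pos hT this
    refine ((h.rate x y).comp hm).congr fun n => ?_
    simp [hxy]
  · rcases eq_or_ne n 0 with rfl | hn
    · simp [h.zero, hxy]
    · have h1 : (n : ℝ) ≠ 0 := by exact_mod_cast hn
      have h2 : (T : ℝ) ≠ 0 := by exact_mod_cast hT.ne'
      rw [mul_div_cancel₀]
      push_cast
      positivity

end IsTransitionFunction

/-! ### Markov chains under a finite measure: martingale increments. -/

/-- Under the finite measure `ν`, the process `X` is a Markov jump process with initial weights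
`w`, transition function `P` and intensity matrix `Q`. -/
structure IsChain {p : ℕ} {Ω : Type*} [MeasurableSpace Ω] (ν : Measure Ω)
    (X : ℝ≥0 → Ω → Fin p) (w : Fin p → ℝ) (P : ℝ≥0 → Matrix (Fin p) (Fin p) ℝ)
    (Q : Matrix (Fin p) (Fin p) ℝ) : Prop where
  measurable : ∀ t, Measurable (X t)
  paths : ∀ᵐ ω ∂ν, IsJumpPath fun t => X t ω
  transition : IsTransitionFunction P Q
  law : ∀ (n : ℕ) (t : Fin (n + 1) → ℝ≥0) (s : Fin (n + 1) → Fin p), Monotone t → t 0 = 0 →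
    ν.real {ω | ∀ i, X (t i) ω = s i} =
      w (s 0) * ∏ i : Fin n, P (t i.succ - t i.castSucc) (s i.castSucc) (s i.succ)

/-- The compensated indicator of a move from `x` to `y` between the times `a` and `a + d`. -/
noncomputable def incr {p : ℕ} (P : ℝ≥0 → Matrix (Fin p) (Fin p) ℝ) (γ : ℝ≥0 → Fin p)
    (a d : ℝ≥0) (x y : Fin p) : ℝ :=
  (if γ a = x then 1 else 0) * ((if γ (a + d) = y then 1 else 0) - P d x y)

namespace IsChain

variable {p : ℕ} {Ω : Type*} [MeasurableSpace Ω] {ν : Measure Ω}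
  {X : ℝ≥0 → Ω → Fin p} {w : Fin p → ℝ} {P : ℝ≥0 → Matrix (Fin p) (Fin p) ℝ}
  {Q : Matrix (Fin p) (Fin p) ℝ}

theorem measurable_comp (h : IsChain ν X w P Q) {ι : Type*} [Finite ι] (t : ι → ℝ≥0)
    (g : (ι → Fin p) → ℝ) : Measurable fun ω => g fun i => X (t i) ω :=
  (measurable_of_finite g).comp (measurable_pi_lambda _ fun i => h.measurable (t i))

variable [IsFiniteMeasure ν]

theorem integrable_comp (h : IsChain ν X w P Q) {ι : Type*} [Finite ι] (t : ι → ℝ≥0)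
    (g : (ι → Fin p) → ℝ) : Integrable (fun ω => g fun i => X (t i) ω) ν :=
  Integrable.of_finite.comp_measurable
    (measurable_pi_lambda _ fun i => h.measurable (t i))

theorem integral_eq_sum (h : IsChain ν X w P Q) {n : ℕ} {t : Fin (n + 1) → ℝ≥0} (ht : Monotone t)
    (ht0 : t 0 = 0) (g : (Fin (n + 1) → Fin p) → ℝ) :
    ∫ ω, g (fun i => X (t i) ω) ∂ν = ∑ s, (w (s 0) *
      ∏ i : Fin n, P (t i.succ - t i.castSucc) (s i.castSucc) (s i.succ)) * g s := by
  have hm : Measurable fun ω i => X (t i) ω := measurable_pi_lambda _ fun i => h.measurable (t i)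
  have := integral_map (μ := ν) hm.aemeasurable
    (measurable_of_finite g).aestronglyMeasurable
  rw [← this, integral_fintype Integrable.of_finite]
  refine Finset.sum_congr rfl fun s _ => ?_
  rw [smul_eq_mul, map_measureReal_apply hm (measurableSet_singleton s), ← h.law n t s ht ht0]
  congr 2
  ext ω
  simp [funext_iff]

/-- The Markov property at the last one of finitely many times. -/
theorem integral_markov (h : IsChain ν X w P Q) {n : ℕ} {t : Fin (n + 1) → ℝ≥0} (ht : Monotone t)
    (ht0 : t 0 = 0) (d : ℝ≥0) (g : (Fin (n + 1) → Fin p) → Fin p → ℝ) :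
    ∫ ω, g (fun i => X (t i) ω) (X (t (Fin.last n) + d) ω) ∂ν =
      ∫ ω, ∑ y, P d (X (t (Fin.last n)) ω) y * g (fun i => X (t i) ω) y ∂ν := by
  let t' : Fin (n + 2) → ℝ≥0 := Fin.snoc t (t (Fin.last n) + d)
  have ht' : Monotone t' := by
    rw [Fin.monotone_iff_le_succ]
    intro i
    refine Fin.lastCases ?_ (fun j => ?_) i
    · simp [t', Fin.succ_last]
    · rw [Fin.succ_castSucc]
      simp only [t', Fin.snoc_castSucc]
      exact ht (Fin.castSucc_lt_succ (i := j)).le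
  have ht0' : t' 0 = 0 := by
    have : t' (Fin.castSucc 0) = 0 := by simp only [t', Fin.snoc_castSucc, ht0]
    simpa using this
  have h1 := h.integral_eq_sum ht' ht0'
    (fun s => g (fun i => s i.castSucc) (s (Fin.last (n + 1))))
  have h2 := h.integral_eq_sum ht ht0 (fun s => ∑ y, P d (s (Fin.last n)) y * g s y)
  simp only [t', Fin.snoc_castSucc, Fin.snoc_last] at h1
  -- Splitting off the last state turns the sum over `n + 2` states into the sum over the past and
  -- the transition from its last state.
  rw [h1, h2, ← (Fin.snocEquiv fun _ => Fin p).sum_comp, Fintype.sum_prod_type, Finset.sum_comm]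
  refine Finset.sum_congr rfl fun s _ => ?_
  rw [Finset.mul_sum]
  refine Finset.sum_congr rfl fun y _ => ?_
  have hs : ∀ i : Fin (n + 1), (Fin.snocEquiv fun _ => Fin p) (y, s) i.castSucc = s i :=
    fun i => Fin.snoc_castSucc (α := fun _ => Fin p) y s i
  have hl : (Fin.snocEquiv fun _ => Fin p) (y, s) (Fin.last (n + 1)) = y :=
    Fin.snoc_last (α := fun _ => Fin p) y s
  rw [Fin.prod_univ_castSucc]
  have h0 : (Fin.snocEquiv fun _ => Fin p) (y, s) 0 = s 0 := hs 0
  simp only [Fin.succ_castSucc, Fin.succ_last, hs, hl, h0, Fin.snoc_castSucc, Fin.snoc_last,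
    add_tsub_cancel_left]
  ring

/-- Increments have mean zero given the past: the mean of `1{z = y} - P d x y` under the row `P d x`
is zero, because the row sums to one. -/
theorem integral_mul_incr (h : IsChain ν X w P Q) {n : ℕ} {t : Fin (n + 1) → ℝ≥0}
    (ht : Monotone t) (ht0 : t 0 = 0) (d : ℝ≥0) (x y : Fin p) (g : (Fin (n + 1) → Fin p) → ℝ) :
    ∫ ω, g (fun i => X (t i) ω) * incr P (fun u => X u ω) (t (Fin.last n)) d x y ∂ν = 0 := by
  have := h.integral_markov ht ht0 d
    (fun s z => g s * ((if s (Fin.last n) = x then 1 else 0) * ((if z = y then 1 else 0) - P d x y)))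
  simp only [incr]
  rw [this]
  refine integral_eq_zero_of_ae (Filter.Eventually.of_forall fun ω => ?_)
  change ∑ z, _ = (0 : ℝ)
  by_cases hx : X (t (Fin.last n)) ω = x
  · rw [Finset.sum_congr rfl (g := fun z => g (fun i => X (t i) ω) *
      (P d x z * (if z = y then 1 else 0) - P d x z * P d x y))
      (fun z _ => by simp only [hx, if_true]; ring), ← Finset.mul_sum, Finset.sum_sub_distrib,
      ← Finset.sum_mul, h.transition.row_sum]
    simp
  · simp [hx]

/-- The expected indicator of the state `x` at the time `t`. -/
noncomputable def stateWeight (w : Fin p → ℝ) (P : ℝ≥0 → Matrix (Fin p) (Fin p) ℝ) (x : Fin p)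
    (t : ℝ≥0) : ℝ := ∑ z, w z * P t z x

theorem integral_state (h : IsChain ν X w P Q) (a : ℝ≥0) (x : Fin p) :
    ∫ ω, (if X a ω = x then (1 : ℝ) else 0) ∂ν = stateWeight w P x a := by
  have h1 := h.integral_markov (n := 0) (t := fun _ => 0) monotone_const rfl a
    (fun _ z => if z = x then 1 else 0)
  simp only [zero_add, mul_ite, mul_one, mul_zero, Finset.sum_ite_eq', Finset.mem_univ,
    if_true] at h1
  rw [h1, h.integral_eq_sum (n := 0) (t := fun _ => 0) monotone_const rfl
    (fun s => P a (s (Fin.last 0)) x), ← (Equiv.funUnique (Fin 1) (Fin p)).symm.sum_comp]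
  simp [stateWeight]

/-- Given the state `x` at time `a`, this is the covariance of two indicators of outcomes of one
draw from the row `P d x`. -/
theorem integral_incr_mul_incr (h : IsChain ν X w P Q) (a d : ℝ≥0) (x y x' y' : Fin p) :
    ∫ ω, incr P (fun u => X u ω) a d x y * incr P (fun u => X u ω) a d x' y' ∂ν =
      kron x x' * (kron y y' * P d x y - P d x y * P d x' y') * stateWeight w P x a := by
  have h1 := h.integral_markov (n := 1) (t := ![0, a])
    (by rw [Fin.monotone_iff_le_succ]; intro i; fin_cases i; simp) rfl d
    (fun s z => ((if s 1 = x then 1 else 0) * ((if z = y then 1 else 0) - P d x y)) *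
      ((if s 1 = x' then 1 else 0) * ((if z = y' then 1 else 0) - P d x' y')))
  have hl : (![0, a] : Fin 2 → ℝ≥0) (Fin.last 1) = a := rfl
  have hl' : (![0, a] : Fin 2 → ℝ≥0) 1 = a := rfl
  simp only [hl, hl'] at h1
  simp only [incr]
  rw [h1, ← h.integral_state, ← integral_const_mul]
  congr 1
  ext ω
  by_cases hx : X a ω = x
  · rw [hx]
    by_cases hxx : x = x'
    · subst hxx
      have : ∀ z, P d x z * ((1 * ((if z = y then 1 else 0) - P d x y)) *
          (1 * ((if z = y' then 1 else 0) - P d x y'))) =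
          (if z = y then P d x z * (if z = y' then 1 else 0) else 0) -
          (if z = y' then P d x z * P d x y else 0) - (if z = y then P d x z * P d x y' else 0) +
          P d x z * (P d x y * P d x y') := by
        intro z; split_ifs <;> ring
      simp only [if_true, this, Finset.sum_add_distrib, Finset.sum_sub_distrib,
        Finset.sum_ite_eq', Finset.mem_univ, ← Finset.sum_mul, h.transition.row_sum, kron]
      by_cases hy : y = y'
      · subst hy; simp
      · simp [hy, Ne.symm hy]; ring
    · simp [hxx, kron, Ne.symm hxx]
  · simp [hx]

end IsChain

/-! ### From the grid to continuous time: moments of compensated jump counts. -/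

/-- The indicator that the path is in `x` at the time `t`. -/
noncomputable def stateInd {p : ℕ} (γ : ℝ≥0 → Fin p) (x : Fin p) (t : ℝ≥0) : ℝ :=
  if γ t = x then 1 else 0

theorem abs_stateInd_le {p : ℕ} (γ : ℝ≥0 → Fin p) (x : Fin p) (t : ℝ≥0) :
    |stateInd γ x t| ≤ 1 := by
  unfold stateInd; split_ifs <;> simp

theorem IsJumpPath.tendsto_gridSum {p : ℕ} {γ : ℝ≥0 → Fin p} (hγ : IsJumpPath γ) (T : ℝ≥0)
    (x : Fin p) :
    Filter.Tendsto (gridSum T (stateInd γ x)) Filter.atTop (𝓝 (occTime T γ x)) := by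
  refine MixtureMJP.tendsto_gridSum T (abs_stateInd_le γ x) fun t => ?_
  refine tendsto_const_nhds.congr' ?_
  filter_upwards [hγ.right_cont t] with s hs
  simp only [stateInd, hs]

theorem IsJumpPath.tendsto_gridCount {p : ℕ} {γ : ℝ≥0 → Fin p} (hγ : IsJumpPath γ) (T : ℝ≥0)
    {x y : Fin p} (hxy : x ≠ y) :
    Filter.Tendsto (gridCount T γ x y) Filter.atTop (𝓝 (jumpCount T γ x y)) := by
  obtain ⟨n₀, hn₀⟩ := hγ.exists_eq_gridCount T
  refine tendsto_const_nhds.congr' ?_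
  filter_upwards [Filter.eventually_ge_atTop n₀] with n hn
  exact (hn₀ n hn x y hxy).2

theorem IsJumpPath.abs_occTime_le {p : ℕ} {γ : ℝ≥0 → Fin p} (hγ : IsJumpPath γ) (T : ℝ≥0)
    (x : Fin p) : |occTime T γ x| ≤ T :=
  le_of_tendsto (hγ.tendsto_gridSum T x).abs (Filter.Eventually.of_forall fun n => by
    simpa using abs_gridSum_le T (abs_stateInd_le γ x) n)

/-- The compensated number of grid intervals over which the path moves from `x` to `y`. -/
noncomputable def gridMart {p : ℕ} (P : ℝ≥0 → Matrix (Fin p) (Fin p) ℝ) (T : ℝ≥0)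
    (γ : ℝ≥0 → Fin p) (x y : Fin p) (n : ℕ) : ℝ :=
  ∑ i ∈ Finset.range n, incr P γ (grid T n i) (T / n) x y

theorem gridMart_eq {p : ℕ} {P : ℝ≥0 → Matrix (Fin p) (Fin p) ℝ} {T : ℝ≥0} {x y : Fin p} {n : ℕ}
    {r : ℝ} (hr : P (T / n) x y = ((T / n : ℝ≥0) : ℝ) * r) (γ : ℝ≥0 → Fin p) :
    gridMart P T γ x y n = gridCount T γ x y n - r * gridSum T (stateInd γ x) n := by
  rw [gridMart, gridCount, gridSum, Finset.mul_sum, ← Finset.sum_sub_distrib]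
  refine Finset.sum_congr rfl fun i _ => ?_
  rw [incr, hr, grid_succ, stateInd]
  by_cases h1 : γ (grid T n i) = x
  · simp only [h1, if_true, true_and]; ring
  · simp only [h1, if_false, false_and]; ring

/-- A form of Fatou's lemma. -/
theorem integrable_of_ae_tendsto_of_integral_le {Ω : Type*} [MeasurableSpace Ω] {ν : Measure Ω}
    {f : ℕ → Ω → ℝ} {g : Ω → ℝ} {C : ℝ} (hf : ∀ n, Integrable (f n) ν) (hf0 : ∀ n ω, 0 ≤ f n ω)
    (hC : ∀ᶠ n in Filter.atTop, ∫ ω, f n ω ∂ν ≤ C)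
    (hlim : ∀ᵐ ω ∂ν, Filter.Tendsto (fun n => f n ω) Filter.atTop (𝓝 (g ω))) :
    Integrable g ν := by
  rw [← memLp_one_iff_integrable]
  refine ⟨aestronglyMeasurable_of_tendsto_ae _ (fun n => (hf n).aestronglyMeasurable) hlim, ?_⟩
  refine lt_of_le_of_lt (Lp.eLpNorm_le_of_ae_tendsto (C := ENNReal.ofReal C) ?_
    (fun n => (hf n).aestronglyMeasurable) hlim) ENNReal.ofReal_lt_top
  filter_upwards [hC] with n hn
  rw [eLpNorm_one_eq_lintegral_enorm, ← ofReal_integral_norm_eq_lintegral_enorm (hf n)]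
  refine ENNReal.ofReal_le_ofReal (le_trans (le_of_eq ?_) hn)
  simp only [Real.norm_eq_abs, abs_of_nonneg (hf0 n _)]

namespace IsChain

variable {p : ℕ} {Ω : Type*} [MeasurableSpace Ω] {ν : Measure Ω}
  {X : ℝ≥0 → Ω → Fin p} {w : Fin p → ℝ} {P : ℝ≥0 → Matrix (Fin p) (Fin p) ℝ}
  {Q : Matrix (Fin p) (Fin p) ℝ}

theorem measurable_initInd (h : IsChain ν X w P Q) (z : Fin p) :
    Measurable fun ω => initInd (fun u => X u ω) z :=
  h.measurable_comp (ι := Unit) (fun _ => 0) (fun s => if s () = z then 1 else 0)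

theorem measurable_stateInd (h : IsChain ν X w P Q) (x : Fin p) (t : ℝ≥0) :
    Measurable fun ω => stateInd (fun u => X u ω) x t :=
  h.measurable_comp (ι := Unit) (fun _ => t) (fun s => if s () = x then 1 else 0)

theorem measurable_gridSum (h : IsChain ν X w P Q) (T : ℝ≥0) (x : Fin p) (n : ℕ) :
    Measurable fun ω => gridSum T (stateInd (fun u => X u ω) x) n :=
  Finset.measurable_fun_sum _ fun _ _ => (h.measurable_stateInd x _).const_mul _

theorem measurable_gridCount (h : IsChain ν X w P Q) (T : ℝ≥0) (x y : Fin p) (n : ℕ) :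
    Measurable fun ω => gridCount T (fun u => X u ω) x y n :=
  Finset.measurable_fun_sum _ fun i _ =>
    h.measurable_comp (t := ![grid T n i, grid T n (i + 1)])
      (fun s : Fin 2 → Fin p => if s 0 = x ∧ s 1 = y then 1 else 0)

theorem measurable_gridMart (h : IsChain ν X w P Q) (T : ℝ≥0) (x y : Fin p) (n : ℕ) :
    Measurable fun ω => gridMart P T (fun u => X u ω) x y n :=
  Finset.measurable_fun_sum _ fun i _ =>
    h.measurable_comp (t := ![grid T n i, grid T n i + T / n])
      (fun s : Fin 2 → Fin p =>
        (if s 0 = x then 1 else 0) * ((if s 1 = y then 1 else 0) - P (T / n) x y))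

theorem tendsto_gridSum_stateWeight (h : IsChain ν X w P Q) (T : ℝ≥0) (x : Fin p) :
    Filter.Tendsto (gridSum T (stateWeight w P x)) Filter.atTop
      (𝓝 (∫ u in (0 : ℝ)..T, stateWeight w P x u.toNNReal)) := by
  have hc : Continuous (stateWeight w P x) :=
    continuous_finsetSum _ fun z _ => (h.transition.continuous_apply z x).const_mul _
  refine tendsto_gridSum T (C := ∑ z, |w z|) (fun t => ?_)
    (fun t => (hc.tendsto t).mono_left nhdsWithin_le_nhds)
  refine (Finset.abs_sum_le_sum_abs _ _).trans (Finset.sum_le_sum fun z _ => ?_)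
  rw [abs_mul, abs_of_nonneg (h.transition.nonneg _ _ _)]
  exact mul_le_of_le_one_right (abs_nonneg _) (h.transition.le_one _ _ _)

/-- The number of jumps from `x` to `y`, minus its compensator. -/
noncomputable def compCount (Q : Matrix (Fin p) (Fin p) ℝ) (T : ℝ≥0) (γ : ℝ≥0 → Fin p)
    (x y : Fin p) : ℝ :=
  jumpCount T γ x y - Q x y * occTime T γ x

theorem tendsto_gridMart (h : IsChain ν X w P Q) (T : ℝ≥0) {x y : Fin p} (hxy : x ≠ y) :
    ∀ᵐ ω ∂ν, Filter.Tendsto (gridMart P T (fun u => X u ω) x y) Filter.atTop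
      (𝓝 (compCount Q T (fun u => X u ω) x y)) := by
  obtain ⟨r, hr, hPr⟩ := h.transition.exists_rate T hxy
  filter_upwards [h.paths] with ω hω
  exact ((hω.tendsto_gridCount T hxy).sub (hr.mul (hω.tendsto_gridSum T x))).congr fun n =>
    (gridMart_eq (hPr n) _).symm

theorem eventually_abs_gridMart_le (h : IsChain ν X w P Q) (T : ℝ≥0) {x y : Fin p}
    (hxy : x ≠ y) : ∀ᶠ n in Filter.atTop, ∀ᵐ ω ∂ν, |gridMart P T (fun u => X u ω) x y n| ≤
      totalCount T (fun u => X u ω) + (|Q x y| + 1) * T := by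
  obtain ⟨r, hr, hPr⟩ := h.transition.exists_rate T hxy
  filter_upwards [hr.abs.eventually_le_const (lt_add_one |Q x y|)] with n hrn
  filter_upwards [h.paths] with ω hω
  rw [gridMart_eq (hPr n)]
  refine (abs_sub _ _).trans (add_le_add ?_ ?_)
  · rw [abs_of_nonneg (gridCount_nonneg _ _ _ _ _)]
    exact hω.gridCount_le T hxy n
  · rw [abs_mul]
    have := abs_gridSum_le T (abs_stateInd_le (fun u => X u ω) x) n
    rw [mul_one] at this
    gcongr

variable [IsFiniteMeasure ν]

theorem integral_incr_mul_incr_of_le (h : IsChain ν X w P Q) {a d b d' : ℝ≥0} (hab : a + d ≤ b)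
    (x y x' y' : Fin p) :
    ∫ ω, incr P (fun u => X u ω) a d x y * incr P (fun u => X u ω) b d' x' y' ∂ν = 0 :=
  h.integral_mul_incr (n := 3) (t := ![0, a, a + d, b])
    (by rw [Fin.monotone_iff_le_succ]; intro i; fin_cases i <;> simp [hab]) rfl d' x' y'
    (fun s => (if s 1 = x then 1 else 0) * ((if s 2 = y then 1 else 0) - P d x y))

theorem integral_state_mul_incr (h : IsChain ν X w P Q) (a d : ℝ≥0) (z x y : Fin p) :
    ∫ ω, initInd (fun u => X u ω) z * incr P (fun u => X u ω) a d x y ∂ν = 0 :=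
  h.integral_mul_incr (n := 1) (t := ![0, a])
    (by rw [Fin.monotone_iff_le_succ]; intro i; fin_cases i; simp) rfl d x y
    (fun s => if s 0 = z then 1 else 0)

theorem integrable_incr_mul_incr (h : IsChain ν X w P Q) (a d b d' : ℝ≥0) (x y x' y' : Fin p) :
    Integrable (fun ω => incr P (fun u => X u ω) a d x y *
      incr P (fun u => X u ω) b d' x' y') ν :=
  h.integrable_comp (t := ![a, a + d, b, b + d']) (fun s : Fin 4 → Fin p =>
    ((if s 0 = x then 1 else 0) * ((if s 1 = y then 1 else 0) - P d x y)) *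
    ((if s 2 = x' then 1 else 0) * ((if s 3 = y' then 1 else 0) - P d' x' y')))

theorem integrable_init_mul_incr (h : IsChain ν X w P Q) (a d : ℝ≥0) (z x y : Fin p) :
    Integrable (fun ω => initInd (fun u => X u ω) z * incr P (fun u => X u ω) a d x y) ν :=
  h.integrable_comp (t := ![0, a, a + d]) (fun s : Fin 3 → Fin p =>
    (if s 0 = z then 1 else 0) *
      ((if s 1 = x then 1 else 0) * ((if s 2 = y then 1 else 0) - P d x y)))

theorem integrable_stateInd (h : IsChain ν X w P Q) (x : Fin p) (t : ℝ≥0) :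
    Integrable (fun ω => stateInd (fun u => X u ω) x t) ν :=
  h.integrable_comp (ι := Unit) (fun _ => t) (fun s => if s () = x then 1 else 0)

theorem integrable_gridMart_mul (h : IsChain ν X w P Q) (T : ℝ≥0) (x y x' y' : Fin p) (n : ℕ) :
    Integrable (fun ω => gridMart P T (fun u => X u ω) x y n *
      gridMart P T (fun u => X u ω) x' y' n) ν := by
  simp only [gridMart, Finset.sum_mul_sum]
  exact integrable_finsetSum _ fun i _ => integrable_finsetSum _ fun j _ =>
    h.integrable_incr_mul_incr _ _ _ _ _ _ _ _

/-- Increments over different grid intervals are orthogonal, so only the diagonal of the double sum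
remains. -/
theorem integral_gridMart_mul (h : IsChain ν X w P Q) (T : ℝ≥0) (x y x' y' : Fin p) (n : ℕ) :
    ∫ ω, gridMart P T (fun u => X u ω) x y n * gridMart P T (fun u => X u ω) x' y' n ∂ν =
      ∑ i ∈ Finset.range n, kron x x' * (kron y y' * P (T / n) x y -
        P (T / n) x y * P (T / n) x' y') * stateWeight w P x (grid T n i) := by
  simp only [gridMart, Finset.sum_mul_sum]
  rw [integral_finsetSum _ fun i _ => integrable_finsetSum _ fun j _ =>
    h.integrable_incr_mul_incr _ _ _ _ _ _ _ _]
  refine Finset.sum_congr rfl fun i hi => ?_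
  rw [integral_finsetSum _ fun j _ => h.integrable_incr_mul_incr _ _ _ _ _ _ _ _,
    Finset.sum_eq_single i, h.integral_incr_mul_incr]
  · intro j _ hji
    rcases lt_or_gt_of_ne hji with hlt | hlt
    · simp only [mul_comm (incr P _ (grid T n i) _ _ _)]
      exact h.integral_incr_mul_incr_of_le
        ((grid_succ T n j).symm.trans_le (grid_mono T n hlt)) _ _ _ _
    · exact h.integral_incr_mul_incr_of_le
        ((grid_succ T n i).symm.trans_le (grid_mono T n hlt)) _ _ _ _
  · exact fun hn => absurd hi hn

theorem integral_init_mul_gridMart (h : IsChain ν X w P Q) (T : ℝ≥0) (z x y : Fin p) (n : ℕ) :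
    ∫ ω, initInd (fun u => X u ω) z * gridMart P T (fun u => X u ω) x y n ∂ν = 0 := by
  simp only [gridMart, Finset.mul_sum]
  rw [integral_finsetSum _ fun i _ => h.integrable_init_mul_incr _ _ _ _ _]
  exact Finset.sum_eq_zero fun i _ => h.integral_state_mul_incr _ _ _ _ _

/-- With `P (T / n) x y = (T / n) r n`, the linear part gives a Riemann sum; the quadratic part has
`n` terms of order `n⁻²` and disappears. -/
theorem tendsto_integral_gridMart_mul (h : IsChain ν X w P Q) (T : ℝ≥0) {x y x' y' : Fin p}
    (hxy : x ≠ y) (hxy' : x' ≠ y') :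
    Filter.Tendsto (fun n => ∫ ω, gridMart P T (fun u => X u ω) x y n *
      gridMart P T (fun u => X u ω) x' y' n ∂ν) Filter.atTop
      (𝓝 (kron x x' * kron y y' * Q x y * ∫ u in (0 : ℝ)..T, stateWeight w P x u.toNNReal)) := by
  obtain ⟨r, hr, hPr⟩ := h.transition.exists_rate T hxy
  obtain ⟨r', hr', hPr'⟩ := h.transition.exists_rate T hxy'
  have hlim := ((((hr.const_mul (kron y y')).sub
    ((hr.mul (tendsto_mesh T)).mul hr')).const_mul (kron x x'))).mul
    (h.tendsto_gridSum_stateWeight T x)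
  rw [mul_zero, zero_mul, sub_zero, ← mul_assoc] at hlim
  refine hlim.congr fun n => ?_
  rw [h.integral_gridMart_mul, hPr, hPr', gridSum, Finset.mul_sum]
  exact Finset.sum_congr rfl fun i _ => by ring

theorem memLp_jumpCount (h : IsChain ν X w P Q) (T : ℝ≥0) {x y : Fin p} (hxy : x ≠ y) :
    MemLp (fun ω => jumpCount T (fun u => X u ω) x y) 2 ν := by
  have hlim : ∀ᵐ ω ∂ν, Filter.Tendsto (gridCount T (fun u => X u ω) x y) Filter.atTop
      (𝓝 (jumpCount T (fun u => X u ω) x y)) := by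
    filter_upwards [h.paths] with ω hω using hω.tendsto_gridCount T hxy
  rw [memLp_two_iff_integrable_sq (aestronglyMeasurable_of_tendsto_ae _
    (fun n => (h.measurable_gridCount T x y n).aestronglyMeasurable) hlim)]
  obtain ⟨r, hr, hPr⟩ := h.transition.exists_rate T hxy
  have hmart := h.tendsto_integral_gridMart_mul T hxy hxy
  set L := kron x x * kron y y * Q x y * ∫ u in (0 : ℝ)..T, stateWeight w P x u.toNNReal
  have hgi : ∀ n, Integrable (fun ω => gridCount T (fun u => X u ω) x y n ^ 2) ν := by
    intro n
    simp only [gridCount, pow_two, Finset.sum_mul_sum]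
    exact integrable_finsetSum _ fun i _ => integrable_finsetSum _ fun j _ =>
      h.integrable_comp (t := ![grid T n i, grid T n (i + 1), grid T n j, grid T n (j + 1)])
        (fun s : Fin 4 → Fin p =>
          (if s 0 = x ∧ s 1 = y then 1 else 0) * (if s 2 = x ∧ s 3 = y then 1 else 0))
  -- The constant comes from `(a + b)² ≤ 2a² + 2b²` for grid count = martingale + compensator:
  -- eventually the martingale has second moment at most `L + 1`, and the compensator is at most
  -- `(|Q x y| + 1) T`.
  refine integrable_of_ae_tendsto_of_integral_le
    (C := 2 * (L + 1) + 2 * ((|Q x y| + 1) * T) ^ 2 * ν.real Set.univ) hgi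
    (fun n ω => sq_nonneg _) ?_ (hlim.mono fun ω hω => hω.pow 2)
  filter_upwards [hmart.eventually_le_const (lt_add_one L),
    hr.abs.eventually_le_const (lt_add_one |Q x y|)] with n hn hrn
  calc ∫ ω, gridCount T (fun u => X u ω) x y n ^ 2 ∂ν
      ≤ ∫ ω, (2 * (gridMart P T (fun u => X u ω) x y n * gridMart P T (fun u => X u ω) x y n) +
        2 * ((|Q x y| + 1) * T) ^ 2) ∂ν := by
        refine integral_mono (hgi n) (((h.integrable_gridMart_mul T x y x y n).const_mul 2).add
          (integrable_const _)) fun ω => ?_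
        have h1 := gridMart_eq (hPr n) fun u => X u ω
        have h2 : |r n * gridSum T (stateInd (fun u => X u ω) x) n| ≤ (|Q x y| + 1) * T := by
          rw [abs_mul]
          have := abs_gridSum_le T (abs_stateInd_le (fun u => X u ω) x) n
          rw [mul_one] at this
          gcongr
        have h3 := sq_le_sq' (neg_le_of_abs_le h2) (le_of_abs_le h2)
        have h4 : gridCount T (fun u => X u ω) x y n = gridMart P T (fun u => X u ω) x y n +
          r n * gridSum T (stateInd (fun u => X u ω) x) n := by rw [h1]; ring
        simp only [h4]
        nlinarith [sq_nonneg (gridMart P T (fun u => X u ω) x y n -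
          r n * gridSum T (stateInd (fun u => X u ω) x) n)]
    _ ≤ _ := by
        rw [integral_add ((h.integrable_gridMart_mul T x y x y n).const_mul 2)
          (integrable_const _), integral_const_mul, integral_const, smul_eq_mul,
          mul_comm (ν.real _)]
        gcongr

theorem memLp_totalCount (h : IsChain ν X w P Q) (T : ℝ≥0) :
    MemLp (fun ω => totalCount T fun u => X u ω) 2 ν :=
  memLp_finsetSum _ fun _ huv => h.memLp_jumpCount T (Finset.mem_filter.1 huv).2

theorem memLp_occTime (h : IsChain ν X w P Q) (T : ℝ≥0) (x : Fin p) :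
    MemLp (fun ω => occTime T (fun u => X u ω) x) 2 ν := by
  refine MemLp.of_bound (aestronglyMeasurable_of_tendsto_ae Filter.atTop
    (fun n => (h.measurable_gridSum T x n).aestronglyMeasurable) ?_) T ?_
  · filter_upwards [h.paths] with ω hω using hω.tendsto_gridSum T x
  · filter_upwards [h.paths] with ω hω using hω.abs_occTime_le T x

/-- Riemann sums replace Fubini, so that measurability of each `X t` is enough and joint
measurability in time and `ω` is not needed. -/
theorem integral_occTime_eq (h : IsChain ν X w P Q) (T : ℝ≥0) (x : Fin p) :
    ∫ ω, occTime T (fun u => X u ω) x ∂ν =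
      ∫ u in (0 : ℝ)..T, stateWeight w P x u.toNNReal := by
  refine tendsto_nhds_unique (tendsto_integral_of_dominated_convergence (fun _ => (T : ℝ))
    (F := fun n ω => gridSum T (stateInd (fun u => X u ω) x) n)
    (fun n => (h.measurable_gridSum T x n).aestronglyMeasurable) (integrable_const _)
    (fun n => Filter.Eventually.of_forall fun ω => by
      simpa using abs_gridSum_le T (abs_stateInd_le (fun u => X u ω) x) n)
    (by filter_upwards [h.paths] with ω hω using hω.tendsto_gridSum T x))
    ((h.tendsto_gridSum_stateWeight T x).congr fun n => ?_)
  simp only [gridSum]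
  rw [integral_finsetSum _ fun i _ => (h.integrable_stateInd x _).const_mul _]
  refine Finset.sum_congr rfl fun i _ => ?_
  rw [integral_const_mul, ← h.integral_state]
  rfl

theorem integral_occTime (h : IsChain ν X w P Q) (T : ℝ≥0) (x : Fin p) :
    ∫ ω, occTime T (fun u => X u ω) x ∂ν =
      ∑ z, w z * ∫ u in (0 : ℝ)..T, NormedSpace.exp (u • Q) z x := by
  have hc : ∀ z, Continuous fun u : ℝ => P u.toNNReal z x := fun z =>
    (h.transition.continuous_apply z x).comp continuous_real_toNNReal
  rw [h.integral_occTime_eq]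
  simp only [stateWeight]
  rw [intervalIntegral.integral_finsetSum fun z _ =>
    ((hc z).const_mul (w z)).intervalIntegrable _ _]
  refine Finset.sum_congr rfl fun z _ => ?_
  rw [intervalIntegral.integral_const_mul]
  congr 1
  refine intervalIntegral.integral_congr fun u hu => ?_
  rw [Set.uIcc_of_le (NNReal.coe_nonneg T)] at hu
  simp only [h.transition.eq_exp, Real.coe_toNNReal _ hu.1]

theorem memLp_compCount (h : IsChain ν X w P Q) (T : ℝ≥0) {x y : Fin p} (hxy : x ≠ y) :
    MemLp (fun ω => compCount Q T (fun u => X u ω) x y) 2 ν :=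
  (h.memLp_jumpCount T hxy).sub ((h.memLp_occTime T x).const_mul (Q x y))

/-- Dominated convergence; the dominating function is a product of two `L²` functions, which is why
the total count had to be square integrable. -/
theorem integral_compCount_mul (h : IsChain ν X w P Q) (T : ℝ≥0) {x y x' y' : Fin p}
    (hxy : x ≠ y) (hxy' : x' ≠ y') :
    ∫ ω, compCount Q T (fun u => X u ω) x y * compCount Q T (fun u => X u ω) x' y' ∂ν =
      kron x x' * kron y y' * Q x y * ∫ ω, occTime T (fun u => X u ω) x ∂ν := by
  rw [h.integral_occTime_eq]
  refine tendsto_nhds_unique (tendsto_integral_filter_of_dominated_convergence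
    (F := fun n ω => gridMart P T (fun u => X u ω) x y n * gridMart P T (fun u => X u ω) x' y' n)
    (fun ω => (totalCount T (fun u => X u ω) + (|Q x y| + 1) * T) *
      (totalCount T (fun u => X u ω) + (|Q x' y'| + 1) * T)) ?_ ?_ ?_ ?_)
    (h.tendsto_integral_gridMart_mul T hxy hxy')
  · exact Filter.Eventually.of_forall fun n =>
      ((h.measurable_gridMart T x y n).mul (h.measurable_gridMart T x' y' n)).aestronglyMeasurable
  · filter_upwards [h.eventually_abs_gridMart_le T hxy, h.eventually_abs_gridMart_le T hxy']
      with n hn hn'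
    filter_upwards [hn, hn'] with ω hω hω'
    rw [norm_mul]
    exact mul_le_mul hω hω' (norm_nonneg _) ((abs_nonneg _).trans hω)
  · exact ((h.memLp_totalCount T).add (memLp_const _)).integrable_mul
      ((h.memLp_totalCount T).add (memLp_const _))
  · filter_upwards [h.tendsto_gridMart T hxy, h.tendsto_gridMart T hxy'] with ω hω hω'
    exact hω.mul hω'

theorem integral_init_mul_compCount (h : IsChain ν X w P Q) (T : ℝ≥0) (z : Fin p) {x y : Fin p}
    (hxy : x ≠ y) :
    ∫ ω, initInd (fun u => X u ω) z * compCount Q T (fun u => X u ω) x y ∂ν = 0 := by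
  refine tendsto_nhds_unique (tendsto_integral_filter_of_dominated_convergence
    (F := fun n ω => initInd (fun u => X u ω) z * gridMart P T (fun u => X u ω) x y n)
    (fun ω => totalCount T (fun u => X u ω) + (|Q x y| + 1) * T) ?_ ?_ ?_ ?_)
    (by simp only [h.integral_init_mul_gridMart]; exact tendsto_const_nhds (f := Filter.atTop))
  · exact Filter.Eventually.of_forall fun n =>
      ((h.measurable_initInd z).mul (h.measurable_gridMart T x y n)).aestronglyMeasurable
  · filter_upwards [h.eventually_abs_gridMart_le T hxy] with n hn
    filter_upwards [hn] with ω hω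
    rw [norm_mul]
    refine (mul_le_of_le_one_left (norm_nonneg _) ?_).trans hω
    exact abs_stateInd_le (fun u => X u ω) z 0
  · exact ((h.memLp_totalCount T).integrable one_le_two).add (integrable_const _)
  · filter_upwards [h.tendsto_gridMart T hxy] with ω hω
    exact hω.const_mul _

theorem integral_compCount (h : IsChain ν X w P Q) (T : ℝ≥0) {x y : Fin p} (hxy : x ≠ y) :
    ∫ ω, compCount Q T (fun u => X u ω) x y ∂ν = 0 := by
  have hsum : ∀ ω, compCount Q T (fun u => X u ω) x y =
      ∑ z, initInd (fun u => X u ω) z * compCount Q T (fun u => X u ω) x y := fun ω => by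
    simp [initInd]
  rw [funext hsum, integral_finsetSum]
  · exact Finset.sum_eq_zero fun z _ => h.integral_init_mul_compCount T z hxy
  · intro z _
    refine ((h.memLp_compCount T hxy).integrable one_le_two).bdd_mul (c := 1)
      (h.measurable_initInd z).aestronglyMeasurable
      (Filter.Eventually.of_forall fun ω => abs_stateInd_le (fun u => X u ω) z 0)

theorem integral_jumpCount (h : IsChain ν X w P Q) (T : ℝ≥0) {x y : Fin p} (hxy : x ≠ y) :
    ∫ ω, jumpCount T (fun u => X u ω) x y ∂ν =
      Q x y * ∫ ω, occTime T (fun u => X u ω) x ∂ν := by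
  have h0 := h.integral_compCount T hxy
  simp only [compCount] at h0
  rw [integral_sub ((h.memLp_jumpCount T hxy).integrable one_le_two)
    (((h.memLp_occTime T x).integrable one_le_two).const_mul _), integral_const_mul] at h0
  linarith

theorem integral_initInd (h : IsChain ν X w P Q) (x : Fin p) :
    ∫ ω, initInd (fun u => X u ω) x ∂ν = w x := by
  refine (h.integral_state 0 x).trans ?_
  simp [stateWeight, h.transition.zero, Matrix.one_apply]

end IsChain

/-! ### Derivatives of the log-likelihood. -/

section Likelihood

variable {p M : ℕ} (T : ℝ≥0) (γ : ℝ≥0 → Fin p) (k : Fin M)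

/-- The coefficient of `log θ_i` in the log-likelihood. -/
noncomputable def coefLog : ParamIdx p M → ℝ :=
  Sum.elim (fun e => regimeInd k e.2 * initInd γ e.1)
    (fun e => regimeInd k e.2 * jumpCount T γ e.1.1.1 e.1.1.2)

/-- The coefficient of `-θ_i` in the log-likelihood. -/
noncomputable def coefLin : ParamIdx p M → ℝ :=
  Sum.elim (fun e => initInd γ e.1) (fun e => regimeInd k e.2 * occTime T γ e.1.1.1)

theorem sum_sum_erase_eq_sum_subtype (F : Fin p → Fin p → ℝ)
    (G : {xy : Fin p × Fin p // xy.1 ≠ xy.2} → ℝ)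
    (h : ∀ x y (hxy : x ≠ y), F x y = G ⟨(x, y), hxy⟩) :
    ∑ x, ∑ y ∈ Finset.univ.erase x, F x y = ∑ e, G e := by
  have h1 : ∑ e, G e = ∑ e : {xy : Fin p × Fin p // xy.1 ≠ xy.2}, F e.1.1 e.1.2 :=
    Finset.sum_congr rfl fun e _ => (h e.1.1 e.1.2 e.2).symm
  rw [h1, ← Finset.sum_subtype (Finset.univ.filter fun xy : Fin p × Fin p => xy.1 ≠ xy.2)
    (by simp) (fun xy => F xy.1 xy.2), Finset.sum_filter, Fintype.sum_prod_type]
  refine Finset.sum_congr rfl fun x _ => ?_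
  rw [← Finset.sum_filter]
  refine Finset.sum_congr ?_ fun _ _ => rfl
  ext y
  simp [eq_comm]

/-- The log-likelihood separates over the coordinates, so mixed second derivatives vanish. The last
sum comes from the `-1` in the constraint term. -/
theorem logLik_eq_sum (θ : ParamIdx p M → ℝ) :
    logLik T γ k θ = ∑ i, (coefLog T γ k i * Real.log (θ i) - coefLin T γ k i * θ i) +
      ∑ x, initInd γ x := by
  have hq : ∀ m, ∑ x, ((∑ y ∈ Finset.univ.erase x,
        regimeInd k m * jumpCount T γ x y * Real.log (rate θ m x y))
        - (∑ y ∈ Finset.univ.erase x, rate θ m x y) * (regimeInd k m * occTime T γ x)) =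
      ∑ e : {xy : Fin p × Fin p // xy.1 ≠ xy.2},
        (coefLog T γ k (Sum.inr (e, m)) * Real.log (θ (Sum.inr (e, m))) -
          coefLin T γ k (Sum.inr (e, m)) * θ (Sum.inr (e, m))) := by
    intro m
    simp only [Finset.sum_mul, ← Finset.sum_sub_distrib]
    refine sum_sum_erase_eq_sum_subtype _ _ fun x y hxy => ?_
    simp only [rate, coefLog, coefLin, Sum.elim_inr, dif_pos hxy]
    ring
  have hp : (∑ m, ∑ x, regimeInd k m * initInd γ x * Real.log (phi θ x m)) -
      (∑ x, initInd γ x * ((∑ m, phi θ x m) - 1)) =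
      ∑ x, ∑ m, (coefLog T γ k (Sum.inl (x, m)) * Real.log (θ (Sum.inl (x, m))) -
          coefLin T γ k (Sum.inl (x, m)) * θ (Sum.inl (x, m))) + ∑ x, initInd γ x := by
    rw [Finset.sum_comm, ← Finset.sum_sub_distrib, ← Finset.sum_add_distrib]
    refine Finset.sum_congr rfl fun x _ => ?_
    rw [Finset.sum_sub_distrib]
    simp only [coefLog, coefLin, Sum.elim_inl, phi, phiIdx, ← Finset.mul_sum]
    ring
  rw [logLik, hp, Finset.sum_congr rfl fun m _ => hq m, Fintype.sum_sum_type,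
    Fintype.sum_prod_type, Fintype.sum_prod_type, Finset.sum_comm (s := Finset.univ (α := Fin M))]
  ring

theorem hasDerivAt_logLik {θ : ParamIdx p M → ℝ} {j : ParamIdx p M} (hj : θ j ≠ 0) :
    HasDerivAt (fun s : ℝ => logLik T γ k (Function.update θ j s))
      (coefLog T γ k j / θ j - coefLin T γ k j) (θ j) := by
  simp only [logLik_eq_sum]
  have hterm : ∀ i ∈ Finset.univ, HasDerivAt (fun s : ℝ =>
      coefLog T γ k i * Real.log (Function.update θ j s i) -
        coefLin T γ k i * Function.update θ j s i)
      (if i = j then coefLog T γ k j / θ j - coefLin T γ k j else 0) (θ j) := by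
    intro i _
    by_cases hij : i = j
    · subst hij
      simp only [Function.update_self, if_true]
      have := ((Real.hasDerivAt_log hj).const_mul (coefLog T γ k i)).fun_sub
        ((hasDerivAt_id (θ i)).const_mul (coefLin T γ k i))
      simpa [div_eq_mul_inv] using this
    · simp only [Function.update_of_ne hij, if_neg hij]
      exact hasDerivAt_const _ _
  have := (HasDerivAt.fun_sum hterm).add_const (∑ x, initInd γ x)
  simpa using this

theorem score_eq {θ : ParamIdx p M → ℝ} {j : ParamIdx p M} (hj : θ j ≠ 0) :
    score T θ j γ k = coefLog T γ k j / θ j - coefLin T γ k j :=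
  (hasDerivAt_logLik T γ k hj).deriv

theorem hasDerivAt_partialD {θ : ParamIdx p M → ℝ} {i j : ParamIdx p M} (hi : θ i ≠ 0)
    (hj : θ j ≠ 0) :
    HasDerivAt (fun s : ℝ => partialD j (logLik T γ k) (Function.update θ i s))
      (if i = j then -coefLog T γ k j / θ j ^ 2 else 0) (θ i) := by
  -- The score formula requires a nonzero `j`-th coordinate. Moving coordinate `i` slightly away
  -- from `θ i ≠ 0` preserves this, whether or not `i = j`.
  have hev : (fun s : ℝ => partialD j (logLik T γ k) (Function.update θ i s)) =ᶠ[𝓝 (θ i)]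
      fun s => coefLog T γ k j / Function.update θ i s j - coefLin T γ k j := by
    filter_upwards [isOpen_ne.mem_nhds hi] with s hs
    refine score_eq T γ k ?_
    by_cases hij : j = i
    · subst hij; simpa using hs
    · simpa [Function.update_of_ne hij] using hj
  refine HasDerivAt.congr_of_eventuallyEq ?_ hev
  by_cases hij : i = j
  · subst hij
    simp only [Function.update_self, if_true]
    have := ((hasDerivAt_inv hi).const_mul (coefLog T γ k i)).sub_const (coefLin T γ k i)
    refine (this.congr_deriv ?_)
    ring
  · simp only [Function.update_of_ne (Ne.symm hij), if_neg hij]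
    exact hasDerivAt_const _ _

theorem hess_eq {θ : ParamIdx p M → ℝ} {i j : ParamIdx p M} (hi : θ i ≠ 0) (hj : θ j ≠ 0) :
    hess T θ i j γ k = if i = j then -coefLog T γ k j / θ j ^ 2 else 0 :=
  (hasDerivAt_partialD T γ k hi hj).deriv

end Likelihood

/-! ### Mixtures: assembling the information matrix. -/

theorem rate_of_ne {p M : ℕ} (θ : ParamIdx p M → ℝ) (m : Fin M) {x y : Fin p} (hxy : x ≠ y) :
    rate θ m x y = θ (rateIdx x y hxy m) := dif_pos hxy

theorem intensity_of_ne {p M : ℕ} (θ : ParamIdx p M → ℝ) (m : Fin M) {x y : Fin p}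
    (hxy : x ≠ y) : intensity θ m x y = rate θ m x y := by
  simp [intensity, hxy]

theorem expectedOcc_eq {p M : ℕ} (T : ℝ≥0) (α : Fin p → ℝ) (θ : ParamIdx p M → ℝ) (n : Fin M)
    (x : Fin p) : expectedOcc T α θ n x = ∑ z, α z * phi θ z n *
      ∫ u in (0 : ℝ)..T, NormedSpace.exp (u • intensity θ n) z x := by
  simp [expectedOcc, dotProduct, Matrix.mulVec_diagonal, mul_assoc]

theorem regimeInd_mul_eq_indicator {M : ℕ} {Ω : Type*} (Φ : Ω → Fin M) (m : Fin M) (f : Ω → ℝ) :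
    (fun ω => regimeInd (Φ ω) m * f ω) = (Φ ⁻¹' {m}).indicator f := by
  ext ω
  by_cases hω : Φ ω = m <;> simp [regimeInd, hω]

theorem regimeInd_mul_regimeInd {M : ℕ} (k m n : Fin M) :
    regimeInd k m * regimeInd k n = kron m n * regimeInd k m := by
  unfold regimeInd kron; split_ifs <;> simp_all

theorem initInd_mul_initInd {p : ℕ} (γ : ℝ≥0 → Fin p) (x y : Fin p) :
    initInd γ x * initInd γ y = kron x y * initInd γ x := by
  unfold initInd kron; split_ifs <;> simp_all

theorem kron_self {β : Type*} [DecidableEq β] (a : β) : kron a a = 1 := if_pos rfl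

theorem sum_regimeInd {M : ℕ} (k : Fin M) : ∑ m, regimeInd k m = 1 := by
  simp [regimeInd]

/-- Transfers facts known on each event `{Φ = m}` to `B_x` itself, which carries no regime
indicator. -/
theorem initInd_eq_sum {p M : ℕ} {Ω : Type*} (X : ℝ≥0 → Ω → Fin p) (Φ : Ω → Fin M)
    (x : Fin p) : (fun ω => initInd (fun t => X t ω) x) =
    fun ω => ∑ m, regimeInd (Φ ω) m * initInd (fun t => X t ω) x := by
  ext ω
  rw [← Finset.sum_mul, sum_regimeInd, one_mul]

namespace IsMixture

variable {p M : ℕ} {Ω : Type*} [MeasurableSpace Ω] {μ : Measure Ω}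
  {X : ℝ≥0 → Ω → Fin p} {Φ : Ω → Fin M} {α : Fin p → ℝ} {θ : ParamIdx p M → ℝ}

theorem measurableSet_regime (h : IsMixture μ X Φ α θ) (m : Fin M) :
    MeasurableSet (Φ ⁻¹' {m}) := h.measurable_regime (measurableSet_singleton m)

theorem integral_regimeInd_mul (h : IsMixture μ X Φ α θ) (m : Fin M) (f : Ω → ℝ) :
    ∫ ω, regimeInd (Φ ω) m * f ω ∂μ = ∫ ω in Φ ⁻¹' {m}, f ω ∂μ := by
  rw [regimeInd_mul_eq_indicator, integral_indicator (h.measurableSet_regime m)]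

theorem memLp_regimeInd_mul (h : IsMixture μ X Φ α θ) {m : Fin M} {f : Ω → ℝ}
    (hf : MemLp f 2 (μ.restrict (Φ ⁻¹' {m}))) : MemLp (fun ω => regimeInd (Φ ω) m * f ω) 2 μ := by
  rw [regimeInd_mul_eq_indicator]
  exact (memLp_indicator_iff_restrict (h.measurableSet_regime m)).2 hf

/-- The restriction is not normalized: the factor `φ_{z,m}` goes into the initial weights, so
regimes of probability zero need no separate treatment. -/
theorem exists_isChain (h : IsMixture μ X Φ α θ) (m : Fin M) :
    ∃ P, IsChain (μ.restrict (Φ ⁻¹' {m})) X (fun z => α z * phi θ z m) P (intensity θ m) := by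
  obtain ⟨P, hP, hlaw⟩ := h.law
  refine ⟨P m, h.measurable_process, ae_restrict_of_ae h.paths, hP m, fun n t s ht ht0 => ?_⟩
  rw [← hlaw m n t s ht ht0, measureReal_restrict_apply' (h.measurableSet_regime m)]
  congr 1
  ext ω
  simp [and_comm]

theorem completeInfo_comm (T : ℝ≥0) (i j : ParamIdx p M) :
    completeInfo μ T X Φ θ i j = completeInfo μ T X Φ θ j i := by
  simp only [completeInfo, mul_comm]

theorem hessInfo_eq_zero (T : ℝ≥0) {i j : ParamIdx p M} (hi : θ i ≠ 0) (hj : θ j ≠ 0)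
    (hij : i ≠ j) : hessInfo μ T X Φ θ i j = 0 := by
  simp [hessInfo, hess_eq T _ _ hi hj, hij]

theorem hessInfo_self (T : ℝ≥0) {i : ParamIdx p M} (hi : θ i ≠ 0) :
    hessInfo μ T X Φ θ i i = (∫ ω, coefLog T (fun t => X t ω) (Φ ω) i ∂μ) / θ i ^ 2 := by
  simp only [hessInfo, hess_eq T _ _ hi hi, if_true, integral_div, integral_neg]
  ring

theorem score_phiIdx (T : ℝ≥0) {x : Fin p} {m : Fin M} (hx : phi θ x m ≠ 0) (γ : ℝ≥0 → Fin p)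
    (k : Fin M) : score T θ (phiIdx x m) γ k =
      (regimeInd k m / phi θ x m - 1) * initInd γ x := by
  rw [score_eq T γ k hx]
  simp only [coefLog, coefLin, Sum.elim_inl, phi]
  ring

theorem score_rateIdx (T : ℝ≥0) {x y : Fin p} (hxy : x ≠ y) {m : Fin M} (hq : rate θ m x y ≠ 0)
    (γ : ℝ≥0 → Fin p) (k : Fin M) : score T θ (rateIdx x y hxy m) γ k =
      (rate θ m x y)⁻¹ * (regimeInd k m * IsChain.compCount (intensity θ m) T γ x y) := by
  have hq' : θ (rateIdx x y hxy m) ≠ 0 := by rwa [← rate_of_ne θ m hxy]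
  rw [score_eq T γ k hq', ← rate_of_ne θ m hxy, IsChain.compCount, intensity_of_ne _ _ hxy]
  simp only [coefLog, coefLin, Sum.elim_inr]
  field_simp

variable [IsFiniteMeasure μ]

theorem integral_regimeInd_mul_initInd (h : IsMixture μ X Φ α θ) (m : Fin M) (x : Fin p) :
    ∫ ω, regimeInd (Φ ω) m * initInd (fun t => X t ω) x ∂μ = α x * phi θ x m := by
  obtain ⟨P, hP⟩ := h.exists_isChain m
  rw [h.integral_regimeInd_mul, hP.integral_initInd]

theorem memLp_regimeInd_mul_initInd (h : IsMixture μ X Φ α θ) (m : Fin M) (x : Fin p) :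
    MemLp (fun ω => regimeInd (Φ ω) m * initInd (fun t => X t ω) x) 2 μ := by
  obtain ⟨P, hP⟩ := h.exists_isChain m
  exact h.memLp_regimeInd_mul (MemLp.of_bound (hP.measurable_initInd x).aestronglyMeasurable 1
    (Filter.Eventually.of_forall fun ω => abs_stateInd_le (fun u => X u ω) x 0))

theorem memLp_initInd (h : IsMixture μ X Φ α θ) (x : Fin p) :
    MemLp (fun ω => initInd (fun t => X t ω) x) 2 μ := by
  rw [initInd_eq_sum X Φ]
  exact memLp_finsetSum _ fun m _ => h.memLp_regimeInd_mul_initInd m x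

theorem integral_initInd (h : IsMixture μ X Φ α θ) (hθ : IsAdmissible θ) (x : Fin p) :
    ∫ ω, initInd (fun t => X t ω) x ∂μ = α x := by
  rw [initInd_eq_sum X Φ, integral_finsetSum _ fun m _ =>
    (h.memLp_regimeInd_mul_initInd m x).integrable one_le_two]
  simp only [h.integral_regimeInd_mul_initInd, ← Finset.mul_sum, hθ.phi_sum, mul_one]

theorem memLp_coefLog (h : IsMixture μ X Φ α θ) (T : ℝ≥0) (i : ParamIdx p M) :
    MemLp (fun ω => coefLog T (fun t => X t ω) (Φ ω) i) 2 μ := by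
  rcases i with ⟨x, m⟩ | ⟨⟨⟨x, y⟩, hxy⟩, m⟩
  · exact h.memLp_regimeInd_mul_initInd m x
  · obtain ⟨P, hP⟩ := h.exists_isChain m
    exact h.memLp_regimeInd_mul (hP.memLp_jumpCount T hxy)

theorem memLp_coefLin (h : IsMixture μ X Φ α θ) (T : ℝ≥0) (i : ParamIdx p M) :
    MemLp (fun ω => coefLin T (fun t => X t ω) (Φ ω) i) 2 μ := by
  rcases i with ⟨x, m⟩ | ⟨⟨⟨x, y⟩, hxy⟩, m⟩
  · exact h.memLp_initInd x
  · obtain ⟨P, hP⟩ := h.exists_isChain m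
    exact h.memLp_regimeInd_mul (hP.memLp_occTime T x)

theorem memLp_score (h : IsMixture μ X Φ α θ) (T : ℝ≥0) {i : ParamIdx p M} (hi : θ i ≠ 0) :
    MemLp (fun ω => score T θ i (fun t => X t ω) (Φ ω)) 2 μ := by
  simp only [score_eq T _ _ hi, div_eq_inv_mul]
  exact ((h.memLp_coefLog T i).const_mul _).sub (h.memLp_coefLin T i)

theorem integrable_hess (h : IsMixture μ X Φ α θ) (T : ℝ≥0) {i j : ParamIdx p M} (hi : θ i ≠ 0)
    (hj : θ j ≠ 0) : Integrable (fun ω => hess T θ i j (fun t => X t ω) (Φ ω)) μ := by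
  simp only [hess_eq T _ _ hi hj]
  split_ifs
  · exact ((h.memLp_coefLog T j).integrable one_le_two).neg.div_const _
  · exact integrable_zero _ _ _

theorem completeInfo_phi (h : IsMixture μ X Φ α θ) (hθ : IsAdmissible θ) (T : ℝ≥0) {x y : Fin p}
    {m n : Fin M} (hx : phi θ x m ≠ 0) (hy : phi θ y n ≠ 0) :
    completeInfo μ T X Φ θ (phiIdx x m) (phiIdx y n) =
      α y / phi θ x m * kron x y * (kron m n - phi θ x m) := by
  by_cases hxy : y = x
  · subst hxy
    have hprod : ∀ ω, score T θ (phiIdx y m) (fun t => X t ω) (Φ ω) *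
        score T θ (phiIdx y n) (fun t => X t ω) (Φ ω) =
        ((kron m n / phi θ y n - 1) / phi θ y m) *
          (regimeInd (Φ ω) m * initInd (fun t => X t ω) y) -
        (phi θ y n)⁻¹ * (regimeInd (Φ ω) n * initInd (fun t => X t ω) y) +
        initInd (fun t => X t ω) y := fun ω => by
      rw [score_phiIdx T hx, score_phiIdx T hy, mul_mul_mul_comm, initInd_mul_initInd]
      have hk : (regimeInd (Φ ω) m / phi θ y m - 1) * (regimeInd (Φ ω) n / phi θ y n - 1) =
          regimeInd (Φ ω) m * regimeInd (Φ ω) n / (phi θ y m * phi θ y n) -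
          regimeInd (Φ ω) m / phi θ y m - regimeInd (Φ ω) n / phi θ y n + 1 := by
        field_simp; ring
      rw [hk, regimeInd_mul_regimeInd, kron_self]
      field_simp
    have hm := ((h.memLp_regimeInd_mul_initInd m y).integrable one_le_two).const_mul
      ((kron m n / phi θ y n - 1) / phi θ y m)
    have hn := ((h.memLp_regimeInd_mul_initInd n y).integrable one_le_two).const_mul
      (phi θ y n)⁻¹
    simp only [completeInfo, hprod]
    have hmn := hm.sub hn
    simp only [Pi.sub_def] at hmn
    rw [integral_add hmn ((h.memLp_initInd y).integrable one_le_two),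
      integral_sub hm hn, integral_const_mul, integral_const_mul,
      h.integral_regimeInd_mul_initInd, h.integral_regimeInd_mul_initInd,
      h.integral_initInd hθ]
    by_cases hmn : n = m
    · subst hmn
      simp only [kron, if_true]
      field_simp
      ring
    · simp only [kron, if_true, if_neg hmn]
      field_simp
      ring
  · have hprod : ∀ ω, score T θ (phiIdx x m) (fun t => X t ω) (Φ ω) *
        score T θ (phiIdx y n) (fun t => X t ω) (Φ ω) = 0 := fun ω => by
      rw [score_phiIdx T hx, score_phiIdx T hy, mul_mul_mul_comm, initInd_mul_initInd, kron,
        if_neg hxy]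
      ring
    simp [completeInfo, hprod, kron, hxy]

/-- On `{Φ = m}` the `φ`-score is a constant times `B_z`, and `B_z` is orthogonal to the compensated
count. -/
theorem completeInfo_phi_rate (h : IsMixture μ X Φ α θ) (T : ℝ≥0) {z x y : Fin p} (hxy : x ≠ y)
    {n m : Fin M} (hz : phi θ z n ≠ 0) (hq : rate θ m x y ≠ 0) :
    completeInfo μ T X Φ θ (phiIdx z n) (rateIdx x y hxy m) = 0 := by
  obtain ⟨P, hP⟩ := h.exists_isChain m
  have hprod : ∀ ω, score T θ (phiIdx z n) (fun t => X t ω) (Φ ω) *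
      score T θ (rateIdx x y hxy m) (fun t => X t ω) (Φ ω) =
      ((kron m n / phi θ z n - 1) * (rate θ m x y)⁻¹) * (regimeInd (Φ ω) m *
        (initInd (fun t => X t ω) z *
          IsChain.compCount (intensity θ m) T (fun t => X t ω) x y)) := fun ω => by
    rw [score_phiIdx T hz, score_rateIdx T hxy hq]
    linear_combination (initInd (fun t => X t ω) z * (rate θ m x y)⁻¹ * (phi θ z n)⁻¹ *
      IsChain.compCount (intensity θ m) T (fun t => X t ω) x y) *
        regimeInd_mul_regimeInd (Φ ω) m n
  simp only [completeInfo, hprod]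
  rw [integral_const_mul, h.integral_regimeInd_mul, hP.integral_init_mul_compCount T z hxy,
    mul_zero]

theorem completeInfo_rate (h : IsMixture μ X Φ α θ) (T : ℝ≥0) {x y x' y' : Fin p} (hxy : x ≠ y)
    (hxy' : x' ≠ y') {m n : Fin M} (hq : rate θ m x y ≠ 0) (hq' : rate θ n x' y' ≠ 0) :
    completeInfo μ T X Φ θ (rateIdx x y hxy m) (rateIdx x' y' hxy' n) =
      kron m n * kron x x' * kron y y' / rate θ n x' y' * expectedOcc T α θ n x := by
  have hprod : ∀ ω, score T θ (rateIdx x y hxy m) (fun t => X t ω) (Φ ω) *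
      score T θ (rateIdx x' y' hxy' n) (fun t => X t ω) (Φ ω) =
      ((rate θ m x y)⁻¹ * (rate θ n x' y')⁻¹ * kron m n) * (regimeInd (Φ ω) m *
        (IsChain.compCount (intensity θ m) T (fun t => X t ω) x y *
          IsChain.compCount (intensity θ n) T (fun t => X t ω) x' y')) := fun ω => by
    rw [score_rateIdx T hxy hq, score_rateIdx T hxy' hq']
    linear_combination ((rate θ m x y)⁻¹ * (rate θ n x' y')⁻¹ *
      IsChain.compCount (intensity θ m) T (fun t => X t ω) x y *
      IsChain.compCount (intensity θ n) T (fun t => X t ω) x' y') *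
        regimeInd_mul_regimeInd (Φ ω) m n
  simp only [completeInfo, hprod]
  by_cases hmn : n = m
  · subst hmn
    obtain ⟨P, hP⟩ := h.exists_isChain n
    rw [integral_const_mul, h.integral_regimeInd_mul, hP.integral_compCount_mul T hxy hxy',
      hP.integral_occTime, ← expectedOcc_eq, intensity_of_ne _ _ hxy]
    field_simp
  · simp [kron, hmn]

/-- On the diagonal `H = E[Φ_m N_xy] / q²`, and the compensator turns the expected count into `q`
times the expected occupation time. -/
theorem hessInfo_rate (h : IsMixture μ X Φ α θ) (T : ℝ≥0) {x y x' y' : Fin p} (hxy : x ≠ y)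
    (hxy' : x' ≠ y') {m n : Fin M} (hq : rate θ m x y ≠ 0) (hq' : rate θ n x' y' ≠ 0) :
    hessInfo μ T X Φ θ (rateIdx x y hxy m) (rateIdx x' y' hxy' n) =
      kron m n * kron x x' * kron y y' / rate θ n x' y' * expectedOcc T α θ n x := by
  by_cases hc : n = m ∧ x' = x ∧ y' = y
  · obtain ⟨rfl, rfl, rfl⟩ := hc
    obtain ⟨P, hP⟩ := h.exists_isChain n
    rw [hessInfo_self T (by rwa [← rate_of_ne θ _ hxy]), ← rate_of_ne θ _ hxy]
    simp only [coefLog, Sum.elim_inr]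
    rw [h.integral_regimeInd_mul, hP.integral_jumpCount T hxy, hP.integral_occTime,
      ← expectedOcc_eq, intensity_of_ne _ _ hxy]
    simp only [kron, if_true]
    field_simp
  · rw [hessInfo_eq_zero T (by rwa [← rate_of_ne θ _ hxy]) (by rwa [← rate_of_ne θ _ hxy'])]
    · unfold kron
      split_ifs <;> simp_all
    · intro heq
      simp only [rateIdx, Sum.inr.injEq, Prod.mk.injEq, Subtype.mk.injEq] at heq
      exact hc ⟨heq.2.symm, heq.1.1.symm, heq.1.2.symm⟩

/-- The linear constraint term contributes `-B_x` to the score but nothing to the Hessian; this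
accounts for the excess. -/
theorem hessInfo_phi (h : IsMixture μ X Φ α θ) (hθ : IsAdmissible θ) (T : ℝ≥0) {x y : Fin p}
    {m n : Fin M} (hx : phi θ x m ≠ 0) (hy : phi θ y n ≠ 0) :
    hessInfo μ T X Φ θ (phiIdx x m) (phiIdx y n) =
      completeInfo μ T X Φ θ (phiIdx x m) (phiIdx y n) + kron x y * α y := by
  rw [h.completeInfo_phi hθ T hx hy]
  by_cases hc : y = x ∧ n = m
  · obtain ⟨rfl, rfl⟩ := hc
    rw [hessInfo_self T hx]
    simp only [coefLog, Sum.elim_inl, h.integral_regimeInd_mul_initInd, kron, if_true]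
    change α y * phi θ y n / phi θ y n ^ 2 = _
    field_simp
    ring
  · rw [hessInfo_eq_zero T hx hy]
    · by_cases hxy : y = x
      · have hmn : n ≠ m := fun hmn => hc ⟨hxy, hmn⟩
        simp only [kron, hxy, hmn, if_true, if_false]
        field_simp
        ring
      · simp [kron, hxy]
    · intro heq
      simp only [phiIdx, Sum.inl.injEq, Prod.mk.injEq] at heq
      exact hc ⟨heq.1.symm, heq.2.symm⟩

end IsMixture

end MixtureMJP
theorem mainTheorem8 {p M : ℕ} {Ω : Type*} [MeasurableSpace Ω] (μ : Measure Ω)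
    [IsProbabilityMeasure μ] (T : ℝ≥0) (X : ℝ≥0 → Ω → Fin p) (Φ : Ω → Fin M)
    (α : Fin p → ℝ) (hα : ∀ x, 0 ≤ α x) (hα_sum : ∑ x, α x = 1)
    (θ₀ : ParamIdx p M → ℝ) (hθ₀ : IsAdmissible θ₀) (hX : IsMixture μ X Φ α θ₀) :
    -- the partial derivatives and the expectations exist
    (∀ i j : ParamIdx p M, θ₀ i ≠ 0 → θ₀ j ≠ 0 →
      (∀ (γ : ℝ≥0 → Fin p) (k : Fin M),
        DifferentiableAt ℝ (fun s : ℝ => logLik T γ k (Function.update θ₀ i s)) (θ₀ i) ∧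
        DifferentiableAt ℝ
          (fun s : ℝ => partialD j (logLik T γ k) (Function.update θ₀ i s)) (θ₀ i)) ∧
      Integrable (fun ω => score T θ₀ i (fun t => X t ω) (Φ ω) *
        score T θ₀ j (fun t => X t ω) (Φ ω)) μ ∧
      Integrable (fun ω => hess T θ₀ i j (fun t => X t ω) (Φ ω)) μ) ∧
    -- the block of `φ`
    (∀ (x y : Fin p) (m n : Fin M), phi θ₀ x m ≠ 0 → phi θ₀ y n ≠ 0 →
      completeInfo μ T X Φ θ₀ (phiIdx x m) (phiIdx y n) =
        α y / phi θ₀ x m * kron x y * (kron m n - phi θ₀ x m)) ∧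
    -- the cross terms
    (∀ (x' x y : Fin p) (hxy : x ≠ y) (n m : Fin M), phi θ₀ x' n ≠ 0 → rate θ₀ m x y ≠ 0 →
      completeInfo μ T X Φ θ₀ (phiIdx x' n) (rateIdx x y hxy m) = 0 ∧
      completeInfo μ T X Φ θ₀ (rateIdx x y hxy m) (phiIdx x' n) = 0) ∧
    -- the block of `q`
    (∀ (x y x' y' : Fin p) (hxy : x ≠ y) (hxy' : x' ≠ y') (m n : Fin M),
      rate θ₀ m x y ≠ 0 → rate θ₀ n x' y' ≠ 0 →
      completeInfo μ T X Φ θ₀ (rateIdx x y hxy m) (rateIdx x' y' hxy' n) =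
        kron m n * kron x x' * kron y y' / rate θ₀ n x' y' * expectedOcc T α θ₀ n x) ∧
    -- the negative expected second derivatives: the cross terms and the block of `q` are the
    -- same, and the blocks of `φ` agree along the directions that preserve `∑ m, φ_{x,m} = 1`
    (∀ (x' x y : Fin p) (hxy : x ≠ y) (n m : Fin M), phi θ₀ x' n ≠ 0 → rate θ₀ m x y ≠ 0 →
      hessInfo μ T X Φ θ₀ (phiIdx x' n) (rateIdx x y hxy m) = 0 ∧
      hessInfo μ T X Φ θ₀ (rateIdx x y hxy m) (phiIdx x' n) = 0) ∧
    (∀ (x y x' y' : Fin p) (hxy : x ≠ y) (hxy' : x' ≠ y') (m n : Fin M),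
      rate θ₀ m x y ≠ 0 → rate θ₀ n x' y' ≠ 0 →
      hessInfo μ T X Φ θ₀ (rateIdx x y hxy m) (rateIdx x' y' hxy' n) =
        kron m n * kron x x' * kron y y' / rate θ₀ n x' y' * expectedOcc T α θ₀ n x) ∧
    ((∀ x m, phi θ₀ x m ≠ 0) →
      ∀ v w : Fin p → Fin M → ℝ, (∀ x, ∑ m, v x m = 0) → (∀ x, ∑ m, w x m = 0) →
        ∑ x, ∑ m, ∑ y, ∑ n, v x m * w y n * hessInfo μ T X Φ θ₀ (phiIdx x m) (phiIdx y n) =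
        ∑ x, ∑ m, ∑ y, ∑ n, v x m * w y n *
          completeInfo μ T X Φ θ₀ (phiIdx x m) (phiIdx y n)) := by
  refine ⟨fun i j hi hj => ⟨fun γ k => ⟨(hasDerivAt_logLik T γ k hi).differentiableAt,
      (hasDerivAt_partialD T γ k hi hj).differentiableAt⟩,
      (hX.memLp_score T hi).integrable_mul (hX.memLp_score T hj), hX.integrable_hess T hi hj⟩,
    fun x y m n hx hy => hX.completeInfo_phi hθ₀ T hx hy,
    fun x' x y hxy n m hx hq => ⟨hX.completeInfo_phi_rate T hxy hx hq,
      (IsMixture.completeInfo_comm T _ _).trans (hX.completeInfo_phi_rate T hxy hx hq)⟩,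
    fun x y x' y' hxy hxy' m n hq hq' => hX.completeInfo_rate T hxy hxy' hq hq',
    fun x' x y hxy n m hx hq => ?_,
    fun x y x' y' hxy hxy' m n hq hq' => hX.hessInfo_rate T hxy hxy' hq hq',
    fun hφ v w hv hw => ?_⟩
  · rw [rate_of_ne θ₀ m hxy] at hq
    exact ⟨IsMixture.hessInfo_eq_zero T hx hq Sum.inl_ne_inr,
      IsMixture.hessInfo_eq_zero T hq hx Sum.inr_ne_inl⟩
  · refine Finset.sum_congr rfl fun x _ => Finset.sum_congr rfl fun m _ =>
      Finset.sum_congr rfl fun y _ => ?_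
    simp only [hX.hessInfo_phi hθ₀ T (hφ _ _) (hφ _ _), mul_add, Finset.sum_add_distrib]
    -- The excess does not depend on `n`, so summing it against `w y` over `n` gives zero.
    rw [← Finset.sum_mul, ← Finset.mul_sum, hw, mul_zero, zero_mul, add_zero]
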